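/- Let $a_+,a_->0$ and $a=(a_++a_-)/2$. Let $G(z)=G(a_+,a_-;z)$ be the hyperbolic gamma function, i.e. the meromorphic function on $\mathbb{C}$ that for $|\mathrm{Im}\,z|<a$ is given by $$G(z)=\exp\Big(i\int_0^\infty\frac{dy}{y}\Big(\frac{\sin 2yz}{2\sinh(a_+y)\sinh(a_-y)}-\frac{z}{a_+a_-y}\Big)\Big),$$ and that satisfies $G(z+ia_\delta/2)=2\cosh(\pi z/a_{-\delta})\,G(z-ia_\delta/2)$ for $\delta=+,-$; its poles are the points $-i(a+ma_++na_-)$ with integers $m,n\ge 0$. For $d\in\mathbb{C}$ and $v,w\in\mathbb{C}^4$ put $$\mathcal{S}_3(d;v,w)=\prod_{k,l=1}^4 G\big(v_k+w_l-\tfrac{i}{4}(a_++a_-)+d\big)\,G\big(v_k+w_l-\tfrac{i}{4}(a_++a_-)-d\big).$$ For $\delta=+,-$ let $c_\delta(z)=\cosh(\pi z/a_\delta)$, $s_\delta(z)=\sinh(\pi z/a_\delta)$, and let $A_{3,\delta}(x)=\sum_{m=1}^4A_{3,\delta}^{(m)}(x)$ be the analytic difference operator acting on meromorphic functions of $x\in\mathbb{C}^4$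 with $$A_{3,\delta}^{(1)}(x)=\frac{c_\delta(x_2-x_3)\,c_\delta(x_3-x_4)\,c_\delta(x_4-x_2)}{s_\delta(x_1-x_2)\,s_\delta(x_1-x_3)\,s_\delta(x_1-x_4)}\exp\Big(\frac{i a_{-\delta}}{4}\big(3\partial_{x_1}-\partial_{x_2}-\partial_{x_3}-\partial_{x_4}\big)\Big),$$ where the exponential denotes the shift $f(x_1,x_2,x_3,x_4)\mapsto f(x_1+\frac{3ia_{-\delta}}{4},x_2-\frac{ia_{-\delta}}{4},x_3-\frac{ia_{-\delta}}{4},x_4-\frac{ia_{-\delta}}{4})$, and with $A_{3,\delta}^{(2)},A_{3,\delta}^{(3)},A_{3,\delta}^{(4)}$ obtained from $A_{3,\delta}^{(1)}$ by cyclic permutation of the indices. Then, for every $d\in\mathbb{C}$, under the constraint $\sum_{j=1}^4v_j=\sum_{j=1}^4w_j=0$ the kernel identities $$A_{3,\delta}(v)\,\mathcal{S}_3(d;v,w)=A_{3,\delta}(w)\,\mathcal{S}_3(d;v,w),\qquad \delta=+,-,$$ hold as identities between meromorphic functions; explicitly, they hold at every such $(v,w)$ with $s_\delta(v_j-v_k)\ne0$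 and $s_\delta(w_j-w_k)\neq 0$ for all $j\ne k$, and such that no gamma function factor of the shifted kernel functions occurring on the two sides has a pole, that is, for no $k,l$ and neither choice of sign is $v_k+w_l-\frac{i}{4}(a_++a_-)-\frac{i}{4}a_{-\delta}\pm d$ a pole of $G$. -/

import Mathlib

noncomputable section

namespace A3Kernel

/-- The function `g(a₊, a₋; z)`, given on the strip `|Im z| < (a₊ + a₋) / 2` by the (there absolutely
convergent) integral
`∫₀^∞ (1/y) (sin (2 y z) / (2 sinh (a₊ y) sinh (a₋ y)) - z / (a₊ a₋ y)) dy`. -/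
def gammaPhase (aP aM : ℝ) (z : ℂ) : ℂ :=
  ∫ y in Set.Ioi (0 : ℝ),
    (1 / (y : ℂ)) *
      (Complex.sin (2 * y * z) / (2 * Complex.sinh (aP * y) * Complex.sinh (aM * y))
        - z / (aP * aM * y))

/-- The least number of steps of length `aM` that bring a point of height `t` below the
height `(aP + aM) / 2`; it is `0` iff `t < (aP + aM) / 2`. -/
def stepCount (aP aM t : ℝ) : ℕ := ⌊(t - (aP + aM) / 2) / aM + 1⌋₊

/-- The hyperbolic gamma function `G(a₊, a₋; z)`. On the strip `|Im z| < (a₊ + a₋) / 2` it is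
`exp (i g(a₊, a₋; z))`, see `hyperbolicGamma_eq_exp`; outside the strip it is the meromorphic
continuation, obtained from `G(z + i a₋ / 2) = 2 cosh (π z / a₊) G(z - i a₋ / 2)`.
(At a pole the second product vanishes and Lean assigns the value `0`.) -/
def hyperbolicGamma (aP aM : ℝ) (z : ℂ) : ℂ :=
  Complex.exp (Complex.I * gammaPhase aP aM
      (z - stepCount aP aM z.im * (Complex.I * aM) + stepCount aP aM (-z.im) * (Complex.I * aM)))
    * (∏ j ∈ Finset.range (stepCount aP aM z.im),
        2 * Complex.cosh (Real.pi * (z - (j + 1 / 2) * (Complex.I * aM)) / aP))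
    / (∏ j ∈ Finset.range (stepCount aP aM (-z.im)),
        2 * Complex.cosh (Real.pi * (z + (j + 1 / 2) * (Complex.I * aM)) / aP))

theorem stepCount_eq_zero {aP aM t : ℝ} (hM : 0 < aM) (ht : t < (aP + aM) / 2) :
    stepCount aP aM t = 0 := by
  have h : (t - (aP + aM) / 2) / aM < 0 := div_neg_of_neg_of_pos (by linarith) hM
  exact Nat.floor_eq_zero.2 (by linarith)

theorem hyperbolicGamma_eq_exp {aP aM : ℝ} (hM : 0 < aM) {z : ℂ}
    (hz : |z.im| < (aP + aM) / 2) :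
    hyperbolicGamma aP aM z = Complex.exp (Complex.I * gammaPhase aP aM z) := by
  have h := abs_lt.1 hz
  simp [hyperbolicGamma, stepCount_eq_zero hM h.2,
    stepCount_eq_zero (aP := aP) hM (t := -z.im) (by linarith)]

/-- The poles of `G(a₊, a₋; ·)`: the points `-i ((a₊ + a₋) / 2 + m a₊ + n a₋)`, `m, n ≥ 0`. -/
def hyperbolicGammaPoles (aP aM : ℝ) : Set ℂ :=
  {z | ∃ m n : ℕ, z = -Complex.I * ((aP + aM) / 2 + m * aP + n * aM)}

/-- The kernel function
`S₃(d; v, w) = ∏_{k,l} G(v_k + w_l - i(a₊ + a₋)/4 + d) G(v_k + w_l - i(a₊ + a₋)/4 - d)`. -/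
def kernelS3 (aP aM : ℝ) (d : ℂ) (v w : Fin 4 → ℂ) : ℂ :=
  ∏ k : Fin 4, ∏ l : Fin 4,
    hyperbolicGamma aP aM (v k + w l - Complex.I * (aP + aM) / 4 + d) *
      hyperbolicGamma aP aM (v k + w l - Complex.I * (aP + aM) / 4 - d)

/-- `c_δ(z) = cosh (π z / α)` with `α = a_δ`. -/
def cFun (α : ℝ) (z : ℂ) : ℂ := Complex.cosh (Real.pi * z / α)

/-- `s_δ(z) = sinh (π z / α)` with `α = a_δ`. -/
def sFun (α : ℝ) (z : ℂ) : ℂ := Complex.sinh (Real.pi * z / α)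

/-- The coefficient of the `m`-th summand of the difference operator; the indices `m + 1`, `m + 2`,
`m + 3` are taken modulo `4`, so that the four coefficients are cyclic permutations of
`c(x₁-x₂) c(x₂-x₃) c(x₃-x₁) / (s(x₀-x₁) s(x₀-x₂) s(x₀-x₃))`. -/
def coeffA3 (α : ℝ) (m : Fin 4) (x : Fin 4 → ℂ) : ℂ :=
  cFun α (x (m + 1) - x (m + 2)) * cFun α (x (m + 2) - x (m + 3)) * cFun α (x (m + 3) - x (m + 1)) /
    (sFun α (x m - x (m + 1)) * sFun α (x m - x (m + 2)) * sFun α (x m - x (m + 3)))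

/-- The point at which `exp ((i β / 4) (3 ∂_m - ∑_{j ≠ m} ∂_j)) f` evaluates `f`. -/
def shiftA3 (β : ℝ) (m : Fin 4) (x : Fin 4 → ℂ) : Fin 4 → ℂ :=
  fun j => if j = m then x j + 3 * (Complex.I * β / 4) else x j - Complex.I * β / 4

/-- The analytic difference operator with coefficient parameter `α` and shift parameter `β`.
`A_{3,+}` is `opA3 a₊ a₋` and `A_{3,-}` is `opA3 a₋ a₊`. -/
def opA3 (α β : ℝ) (f : (Fin 4 → ℂ) → ℂ) (x : Fin 4 → ℂ) : ℂ :=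
  ∑ m : Fin 4, coeffA3 α m x * f (shiftA3 β m x)

/-- The points `(v, w)` at which no factor of the two sides of the kernel identity for
`opA3 α β` is singular: the denominators of the coefficients do not vanish, and no argument of
the gamma function in a shifted kernel function is a pole. The shifted arguments are
`u - i β / 4` and `u + 3 i β / 4` with `u = v_k + w_l - i(a₊ + a₋)/4 ± d`; as `β` is `a₊` or `a₋`, the
second one can be a pole only if the first one is. -/
structure IsRegularPoint (aP aM α β : ℝ) (d : ℂ) (v w : Fin 4 → ℂ) : Prop where
  left_ne : ∀ j k : Fin 4, j ≠ k → sFun α (v j - v k) ≠ 0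
  right_ne : ∀ j k : Fin 4, j ≠ k → sFun α (w j - w k) ≠ 0
  not_pole_add : ∀ k l : Fin 4,
    v k + w l - Complex.I * (aP + aM) / 4 - Complex.I * β / 4 + d ∉ hyperbolicGammaPoles aP aM
  not_pole_sub : ∀ k l : Fin 4,
    v k + w l - Complex.I * (aP + aM) / 4 - Complex.I * β / 4 - d ∉ hyperbolicGammaPoles aP aM

end A3Kernel

end

noncomputable section

namespace A3Kernel

/-! ### The rational identity behind the kernel identity -/

/-! Write `α`, `β` for the coefficient and shift parameters. The shifts `3iβ/4` and `-iβ/4` differ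
by `iβ`, one step of the difference equation of `G`. Hence every shifted kernel function on either
side is one common product, with all arguments moved by `-iβ/4`, times eight cosh factors belonging
to one row (shift in `v`) or one column (shift in `w`). What remains is `hyperbolic_identity`.

In the variables `x_j = exp (2πv_j/α)`, whose product is 1 by the constraint, and likewise for `w`,
each side is a sum over the nodes of the type met in Lagrange interpolation. `rational_sum_eq`
evaluates it in elementary symmetric functions, and the value is symmetric under exchange of the two
sets of variables.

The analytic half establishes the difference equations for the concrete `hyperbolicGamma`. In the
strip, the step `c` amounts to `∫ (1/y)(1/y - cos 2yz / sinh y) dy = log (2 cosh πz)`, in the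
exponentiated form `exp_coshPhase`: differentiating in `z` gives `π tanh πz` by partial fractions,
and a duplication formula fixes the constant. The continuation has the step `a₋` built in. The step
`a₊` holds in the strip by symmetry of the phase, on its boundary by continuity, and higher up by
induction. The reflection `G(-z) = 1/G(z)` transfers both steps to the lower half plane. -/

/-- The third divided difference of a cubic is its leading coefficient. The denominators are ordered
cyclically to match the indices `m + 1`, `m + 2`, `m + 3` in `coeffA3`. -/
theorem lagrange_sum_cubic {x₀ x₁ x₂ x₃ : ℂ} (h01 : x₀ - x₁ ≠ 0) (h02 : x₀ - x₂ ≠ 0)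
    (h03 : x₀ - x₃ ≠ 0) (h12 : x₁ - x₂ ≠ 0) (h13 : x₁ - x₃ ≠ 0) (h23 : x₂ - x₃ ≠ 0)
    (c₀ c₁ c₂ c₃ : ℂ) :
    (c₀ + c₁ * x₀ + c₂ * x₀ ^ 2 + c₃ * x₀ ^ 3) / ((x₀ - x₁) * (x₀ - x₂) * (x₀ - x₃)) +
      (c₀ + c₁ * x₁ + c₂ * x₁ ^ 2 + c₃ * x₁ ^ 3) / ((x₁ - x₂) * (x₁ - x₃) * (x₁ - x₀)) +
      (c₀ + c₁ * x₂ + c₂ * x₂ ^ 2 + c₃ * x₂ ^ 3) / ((x₂ - x₃) * (x₂ - x₀) * (x₂ - x₁)) +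
      (c₀ + c₁ * x₃ + c₂ * x₃ ^ 2 + c₃ * x₃ ^ 3) / ((x₃ - x₀) * (x₃ - x₁) * (x₃ - x₂)) = c₃ := by
  rw [← neg_sub x₀ x₁, ← neg_sub x₀ x₂, ← neg_sub x₀ x₃, ← neg_sub x₁ x₂, ← neg_sub x₁ x₃,
    ← neg_sub x₂ x₃]
  field_simp
  ring

/-- The first elementary symmetric function of four variables. -/
def esym1 (x : Fin 4 → ℂ) : ℂ := x 0 + x 1 + x 2 + x 3

/-- The second elementary symmetric function of four variables. -/
def esym2 (x : Fin 4 → ℂ) : ℂ :=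
  x 0 * x 1 + x 0 * x 2 + x 0 * x 3 + x 1 * x 2 + x 1 * x 3 + x 2 * x 3

/-- The third elementary symmetric function of four variables. -/
def esym3 (x : Fin 4 → ℂ) : ℂ :=
  x 0 * x 1 * x 2 + x 0 * x 1 * x 3 + x 0 * x 2 * x 3 + x 1 * x 2 * x 3

theorem prod_one_add_mul (w : Fin 4 → ℂ) (hw : w 0 * w 1 * w 2 * w 3 = 1) (A t : ℂ) :
    ∏ l, (1 + A * (t * w l)) =
      1 + esym1 w * (A * t) + esym2 w * (A * t) ^ 2 + esym3 w * (A * t) ^ 3 + (A * t) ^ 4 := by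
  simp only [Fin.prod_univ_four, esym1, esym2, esym3]
  linear_combination (A * t) ^ 4 * hw

/-- As `AB = -1`, the coefficients depend on `A` and `B` only through `A + B`, and the two end
coefficients agree. This is the shape required by `weighted_sum_eq`. -/
theorem quartic_mul_quartic {A B : ℂ} (hAB : A * B = -1) (e₁ e₂ e₃ t : ℂ) :
    (1 + e₁ * (A * t) + e₂ * (A * t) ^ 2 + e₃ * (A * t) ^ 3 + (A * t) ^ 4) *
        (1 + e₁ * (B * t) + e₂ * (B * t) ^ 2 + e₃ * (B * t) ^ 3 + (B * t) ^ 4) =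
      1 + e₁ * (A + B) * t + (e₂ * ((A + B) ^ 2 + 2) - e₁ ^ 2) * t ^ 2
        + (e₃ * ((A + B) ^ 3 + 3 * (A + B)) - e₁ * e₂ * (A + B)) * t ^ 3
        + ((A + B) ^ 4 + 4 * (A + B) ^ 2 + 2 - e₁ * e₃ * ((A + B) ^ 2 + 2) + e₂ ^ 2) * t ^ 4
        + (-e₁ * ((A + B) ^ 3 + 3 * (A + B)) + e₂ * e₃ * (A + B)) * t ^ 5
        + (e₂ * ((A + B) ^ 2 + 2) - e₃ ^ 2) * t ^ 6 - e₃ * (A + B) * t ^ 7 + t ^ 8 := by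
  have hA : A ≠ 0 := by rintro rfl; simp at hAB
  obtain rfl : B = -A⁻¹ := by field_simp; linear_combination hAB
  field_simp
  ring

/-- The moments `∑ y_m x_m ^ n` satisfy the recursion of the characteristic polynomial, which runs
both ways because its constant term is 1. The consecutive values 0, 0, 0, 1 therefore determine all
the moments. The even coefficients `p₀, p₂, p₄, p₆` cancel from the result. -/
theorem weighted_sum_eq (y x : Fin 4 → ℂ) (f₁ f₂ f₃ : ℂ)
    (hx : ∀ m, x m ^ 4 = f₁ * x m ^ 3 - f₂ * x m ^ 2 + f₃ * x m - 1)
    (h2 : ∑ m, y m * x m ^ 2 = 0) (h3 : ∑ m, y m * x m ^ 3 = 0) (h4 : ∑ m, y m * x m ^ 4 = 0)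
    (h5 : ∑ m, y m * x m ^ 5 = 1) (p₀ p₁ p₂ p₃ p₄ p₅ p₆ p₇ : ℂ) :
    ∑ m, y m * (((f₁ * f₂ - f₃) - f₁ ^ 2 * x m + f₁ * x m ^ 2) *
      (p₀ + p₁ * x m + p₂ * x m ^ 2 + p₃ * x m ^ 3 + p₄ * x m ^ 4 + p₅ * x m ^ 5 + p₆ * x m ^ 6
        + p₇ * x m ^ 7 + p₀ * x m ^ 8)) =
      (f₃ - f₁ * f₂) * p₁ + f₁ * p₃ - f₃ * p₅ + (f₂ * f₃ - f₁) * p₇ := by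
  set U : ℕ → ℂ := fun n => ∑ m, y m * x m ^ n with hU
  have hrec : ∀ n, U (n + 4) = f₁ * U (n + 3) - f₂ * U (n + 2) + f₃ * U (n + 1) - U n := by
    intro n
    simp only [hU, Finset.mul_sum, ← Finset.sum_sub_distrib, ← Finset.sum_add_distrib]
    refine Finset.sum_congr rfl fun m _ => ?_
    linear_combination y m * x m ^ n * hx m
  replace h2 : U 2 = 0 := h2
  replace h3 : U 3 = 0 := h3
  replace h4 : U 4 = 0 := h4
  replace h5 : U 5 = 1 := h5
  have h1 : U 1 = -1 := by linear_combination f₁ * h4 - f₂ * h3 + f₃ * h2 - h5 + hrec 1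
  have h0 : U 0 = -f₃ := by linear_combination f₁ * h3 - f₂ * h2 + f₃ * h1 - h4 + hrec 0
  have h6 : U 6 = f₁ := by rw [hrec 2, h5, h4, h3, h2]; ring
  have h7 : U 7 = f₁ ^ 2 - f₂ := by rw [hrec 3, h6, h5, h4, h3]; ring
  have h8 : U 8 = f₁ ^ 3 - 2 * f₁ * f₂ + f₃ := by rw [hrec 4, h7, h6, h5, h4]; ring
  have h9 : U 9 = f₁ ^ 4 - 3 * f₁ ^ 2 * f₂ + 2 * f₁ * f₃ + f₂ ^ 2 - 1 := by
    rw [hrec 5, h8, h7, h6, h5]; ring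
  have h10 := hrec 6
  rw [h9, h8, h7, h6] at h10
  have hsum : ∑ m, y m * (((f₁ * f₂ - f₃) - f₁ ^ 2 * x m + f₁ * x m ^ 2) *
      (p₀ + p₁ * x m + p₂ * x m ^ 2 + p₃ * x m ^ 3 + p₄ * x m ^ 4 + p₅ * x m ^ 5 + p₆ * x m ^ 6
        + p₇ * x m ^ 7 + p₀ * x m ^ 8)) =
      (f₁ * f₂ - f₃) * (p₀ * U 0 + p₁ * U 1 + p₂ * U 2 + p₃ * U 3 + p₄ * U 4 + p₅ * U 5 + p₆ * U 6
        + p₇ * U 7 + p₀ * U 8)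
      - f₁ ^ 2 * (p₀ * U 1 + p₁ * U 2 + p₂ * U 3 + p₃ * U 4 + p₄ * U 5 + p₅ * U 6 + p₆ * U 7
        + p₇ * U 8 + p₀ * U 9)
      + f₁ * (p₀ * U 2 + p₁ * U 3 + p₂ * U 4 + p₃ * U 5 + p₄ * U 6 + p₅ * U 7 + p₆ * U 8
        + p₇ * U 9 + p₀ * U 10) := by
    simp only [hU, Fin.sum_univ_four]
    ring
  rw [hsum, h0, h1, h2, h3, h4, h5, h6, h7, h8, h9, h10]
  ring

/-- The point of the closed form is its invariance under `x ↔ w`, invisible in the sum. -/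
theorem rational_sum_eq (x w : Fin 4 → ℂ) (hne : ∀ j k, j ≠ k → x j - x k ≠ 0)
    (hx : x 0 * x 1 * x 2 * x 3 = 1) (hw : w 0 * w 1 * w 2 * w 3 = 1) {A B : ℂ}
    (hAB : A * B = -1) :
    ∑ m, (x (m + 1) + x (m + 2)) * (x (m + 2) + x (m + 3)) * (x (m + 3) + x (m + 1)) /
        ((x m - x (m + 1)) * (x m - x (m + 2)) * (x m - x (m + 3))) / x m ^ 2 *
        ∏ l, (1 + A * (x m * w l)) * (1 + B * (x m * w l)) =
      (A + B) * ((4 + (A + B) ^ 2) * (esym1 x * esym3 w + esym1 w * esym3 x) -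
        (esym2 x + esym2 w) * (esym1 x * esym1 w + esym3 x * esym3 w)) := by
  have hx0 : ∀ m, x m ≠ 0 := by
    intro m h
    fin_cases m <;> simp at h <;> simp [h] at hx
  have key := lagrange_sum_cubic (hne 0 1 (by decide)) (hne 0 2 (by decide)) (hne 0 3 (by decide))
    (hne 1 2 (by decide)) (hne 1 3 (by decide)) (hne 2 3 (by decide))
  have hchar : ∀ m, x m ^ 4 = esym1 x * x m ^ 3 - esym2 x * x m ^ 2 + esym3 x * x m - 1 := by
    intro m
    simp only [esym1, esym2, esym3]
    fin_cases m <;> simp <;> linear_combination -hx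
  have hpow : ∀ n m, 1 / ((x m - x (m + 1)) * (x m - x (m + 2)) * (x m - x (m + 3))) / x m ^ 2 *
      x m ^ (n + 2) = x m ^ n / ((x m - x (m + 1)) * (x m - x (m + 2)) * (x m - x (m + 3))) := by
    intro n m
    have := hx0 m
    rw [pow_add]
    field_simp
  -- With `g_i` the elementary symmetric functions of the three variables other than `x m`, the
  -- product is `g₁g₂ - g₃ = e₁g₂ - e₃`, and `g₂ = e₂ - x_m (e₁ - x_m)`.
  have hq : ∀ m, (x (m + 1) + x (m + 2)) * (x (m + 2) + x (m + 3)) * (x (m + 3) + x (m + 1)) =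
      (esym1 x * esym2 x - esym3 x) - esym1 x ^ 2 * x m + esym1 x * x m ^ 2 := by
    intro m
    simp only [esym1, esym2, esym3]
    fin_cases m <;> simp <;> ring
  have hW := weighted_sum_eq
    (fun m => 1 / ((x m - x (m + 1)) * (x m - x (m + 2)) * (x m - x (m + 3))) / x m ^ 2) x
    (esym1 x) (esym2 x) (esym3 x) hchar
    (by simp only [hpow 0]; simpa [Fin.sum_univ_four] using key 1 0 0 0)
    (by simp only [hpow 1]; simpa [Fin.sum_univ_four] using key 0 1 0 0)
    (by simp only [hpow 2]; simpa [Fin.sum_univ_four] using key 0 0 1 0)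
    (by simp only [hpow 3]; simpa [Fin.sum_univ_four] using key 0 0 0 1)
    1 (esym1 w * (A + B)) (esym2 w * ((A + B) ^ 2 + 2) - esym1 w ^ 2)
    (esym3 w * ((A + B) ^ 3 + 3 * (A + B)) - esym1 w * esym2 w * (A + B))
    ((A + B) ^ 4 + 4 * (A + B) ^ 2 + 2 - esym1 w * esym3 w * ((A + B) ^ 2 + 2) + esym2 w ^ 2)
    (-esym1 w * ((A + B) ^ 3 + 3 * (A + B)) + esym2 w * esym3 w * (A + B))
    (esym2 w * ((A + B) ^ 2 + 2) - esym3 w ^ 2) (-esym3 w * (A + B))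
  refine (Finset.sum_congr rfl fun m _ => ?_).trans (hW.trans (by ring))
  rw [Finset.prod_mul_distrib, prod_one_add_mul w hw, prod_one_add_mul w hw,
    quartic_mul_quartic hAB, hq]
  ring

open Complex

/-! ### The hyperbolic form of the identity -/

theorem cFun_sub (α : ℝ) (a b : ℂ) : cFun α (a - b) =
    (exp (Real.pi * a / α) ^ 2 + exp (Real.pi * b / α) ^ 2) /
      (2 * exp (Real.pi * a / α) * exp (Real.pi * b / α)) := by
  have ha := exp_ne_zero (Real.pi * a / α)
  have hb := exp_ne_zero (Real.pi * b / α)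
  rw [cFun, cosh, mul_sub, sub_div, neg_sub, exp_sub, exp_sub]
  field_simp

theorem sFun_sub (α : ℝ) (a b : ℂ) : sFun α (a - b) =
    (exp (Real.pi * a / α) ^ 2 - exp (Real.pi * b / α) ^ 2) /
      (2 * exp (Real.pi * a / α) * exp (Real.pi * b / α)) := by
  have ha := exp_ne_zero (Real.pi * a / α)
  have hb := exp_ne_zero (Real.pi * b / α)
  rw [sFun, mul_sub, sub_div, sinh, neg_sub, exp_sub, exp_sub]
  field_simp

/-- Each factor is `2 cosh θ = exp (-θ) (1 + exp 2θ)`. The offset `-iα/4` contributes `exp (-iπ/2) =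
-i` to `exp 2θ`, so the constants `A`, `B` in front of the squared exponential satisfy `AB = -1`. -/
theorem two_mul_cosh_mul_two_mul_cosh {α : ℝ} (hα : α ≠ 0) (z d : ℂ) :
    2 * cosh (Real.pi * (z - I * α / 4 + d) / α) * (2 * cosh (Real.pi * (z - I * α / 4 - d) / α)) =
      I * (exp (Real.pi * z / α) ^ 2)⁻¹ *
        ((1 + -I * exp (2 * Real.pi * d / α) * exp (Real.pi * z / α) ^ 2) *
          (1 + -I * (exp (2 * Real.pi * d / α))⁻¹ * exp (Real.pi * z / α) ^ 2)) := by
  have hα' : (α : ℂ) ≠ 0 := by exact_mod_cast hα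
  have key : ∀ θ : ℂ, 2 * cosh θ = exp (-θ) * (1 + exp (2 * θ)) := by
    intro θ
    rw [two_cosh, mul_add, ← exp_add]; ring_nf
  have hI : exp (-(Real.pi / 2 * I)) = -I := by
    rw [exp_neg, exp_pi_div_two_mul_I, inv_I]
  have hA : ∀ c : ℂ, exp (2 * (Real.pi * (z - I * α / 4 + c) / α)) =
      -I * exp (2 * Real.pi * c / α) * exp (Real.pi * z / α) ^ 2 := by
    intro c
    rw [← hI, ← exp_nat_mul, ← exp_add, ← exp_add]
    congr 1
    push_cast
    field_simp
    ring
  have hB : exp (-(Real.pi * (z - I * α / 4 + d) / α)) * exp (-(Real.pi * (z - I * α / 4 + -d) / α)) =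
      I * (exp (Real.pi * z / α) ^ 2)⁻¹ := by
    conv_rhs => rw [← exp_pi_div_two_mul_I]
    rw [← exp_nat_mul, ← exp_neg, ← exp_add, ← exp_add]
    congr 1
    push_cast
    field_simp
    ring
  rw [sub_eq_add_neg _ d, key, key, hA, hA, ← exp_neg, ← hB]
  have : 2 * Real.pi * -d / α = -(2 * Real.pi * d / α) := by ring
  rw [this]
  ring

theorem prod_exp_eq_one {α : ℝ} {v : Fin 4 → ℂ} (hv : ∑ j, v j = 0) :
    exp (Real.pi * v 0 / α) * exp (Real.pi * v 1 / α) * exp (Real.pi * v 2 / α) *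
      exp (Real.pi * v 3 / α) = 1 := by
  rw [← exp_add, ← exp_add, ← exp_add, ← exp_zero]
  rw [Fin.sum_univ_four] at hv
  congr 1
  linear_combination (Real.pi / α : ℂ) * hv

theorem coeffA3_mul_prod {α : ℝ} (hα : α ≠ 0) (d : ℂ) {v w : Fin 4 → ℂ} (hv : ∑ j, v j = 0)
    (hw : ∑ j, w j = 0) (m : Fin 4) :
    coeffA3 α m v * ∏ l, 2 * cosh (Real.pi * (v m + w l - I * α / 4 + d) / α) *
        (2 * cosh (Real.pi * (v m + w l - I * α / 4 - d) / α)) =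
      (exp (Real.pi * v (m + 1) / α) ^ 2 + exp (Real.pi * v (m + 2) / α) ^ 2) *
        (exp (Real.pi * v (m + 2) / α) ^ 2 + exp (Real.pi * v (m + 3) / α) ^ 2) *
        (exp (Real.pi * v (m + 3) / α) ^ 2 + exp (Real.pi * v (m + 1) / α) ^ 2) /
        ((exp (Real.pi * v m / α) ^ 2 - exp (Real.pi * v (m + 1) / α) ^ 2) *
          (exp (Real.pi * v m / α) ^ 2 - exp (Real.pi * v (m + 2) / α) ^ 2) *
          (exp (Real.pi * v m / α) ^ 2 - exp (Real.pi * v (m + 3) / α) ^ 2)) /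
        (exp (Real.pi * v m / α) ^ 2) ^ 2 *
        ∏ l, (1 + -I * exp (2 * Real.pi * d / α) *
            (exp (Real.pi * v m / α) ^ 2 * exp (Real.pi * w l / α) ^ 2)) *
          (1 + -I * (exp (2 * Real.pi * d / α))⁻¹ *
            (exp (Real.pi * v m / α) ^ 2 * exp (Real.pi * w l / α) ^ 2)) := by
  have hE : ∀ l, exp (Real.pi * (v m + w l) / α) = exp (Real.pi * v m / α) * exp (Real.pi * w l / α) := by
    intro l
    rw [← exp_add]; ring_nf
  -- The power -8 here and the power 4 in `hcoeff` combine to the divisor `x_m ^ 2` of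
  -- `rational_sum_eq`, with `x_m` the squared exponential; the phase disappears as `I ^ 4 = 1`.
  have hfirst : ∏ l, I * ((exp (Real.pi * v m / α) * exp (Real.pi * w l / α)) ^ 2)⁻¹ =
      (exp (Real.pi * v m / α) ^ 8)⁻¹ := by
    have h1 := prod_exp_eq_one (α := α) hw
    have h2 : (∏ l, (exp (Real.pi * v m / α) * exp (Real.pi * w l / α)) ^ 2) =
        exp (Real.pi * v m / α) ^ 8 := by
      rw [Fin.prod_univ_four]
      calc _ = exp (Real.pi * v m / α) ^ 8 * (exp (Real.pi * w 0 / α) * exp (Real.pi * w 1 / α) *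
            exp (Real.pi * w 2 / α) * exp (Real.pi * w 3 / α)) ^ 2 := by ring
        _ = _ := by rw [h1]; ring
    rw [Finset.prod_mul_distrib, Finset.prod_inv_distrib, h2]
    simp
  have hvm : exp (Real.pi * v (m + 1) / α) * exp (Real.pi * v (m + 2) / α) *
      exp (Real.pi * v (m + 3) / α) = (exp (Real.pi * v m / α))⁻¹ := by
    have h1 := prod_exp_eq_one (α := α) hv
    apply eq_inv_of_mul_eq_one_left
    fin_cases m <;> simp <;> linear_combination h1
  have hcoeff : coeffA3 α m v =
      (exp (Real.pi * v (m + 1) / α) ^ 2 + exp (Real.pi * v (m + 2) / α) ^ 2) *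
        (exp (Real.pi * v (m + 2) / α) ^ 2 + exp (Real.pi * v (m + 3) / α) ^ 2) *
        (exp (Real.pi * v (m + 3) / α) ^ 2 + exp (Real.pi * v (m + 1) / α) ^ 2) /
        ((exp (Real.pi * v m / α) ^ 2 - exp (Real.pi * v (m + 1) / α) ^ 2) *
          (exp (Real.pi * v m / α) ^ 2 - exp (Real.pi * v (m + 2) / α) ^ 2) *
          (exp (Real.pi * v m / α) ^ 2 - exp (Real.pi * v (m + 3) / α) ^ 2)) *
        exp (Real.pi * v m / α) ^ 4 := by
    have h0 := exp_ne_zero (Real.pi * v m / α)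
    have ha := exp_ne_zero (Real.pi * v (m + 1) / α)
    have hb := exp_ne_zero (Real.pi * v (m + 2) / α)
    have hc := exp_ne_zero (Real.pi * v (m + 3) / α)
    -- The quotient on the right is what the denominators of `cFun_sub` and `sFun_sub` leave behind;
    -- the constraint on `v` makes it a pure power.
    have h4 : exp (Real.pi * v m / α) ^ 4 = exp (Real.pi * v m / α) ^ 3 /
        (exp (Real.pi * v (m + 1) / α) * exp (Real.pi * v (m + 2) / α) *
          exp (Real.pi * v (m + 3) / α)) := by
      rw [hvm]; field_simp
    rw [h4, coeffA3]
    simp only [cFun_sub, sFun_sub]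
    field_simp
  simp only [two_mul_cosh_mul_two_mul_cosh hα, hE]
  rw [Finset.prod_mul_distrib, hfirst, hcoeff]
  have h0 := exp_ne_zero (Real.pi * v m / α)
  simp only [mul_pow]
  field_simp

/-- The kernel identity after division by the common gamma function factors. -/
theorem hyperbolic_identity {α : ℝ} (hα : α ≠ 0) (d : ℂ) {v w : Fin 4 → ℂ} (hv : ∑ j, v j = 0)
    (hw : ∑ j, w j = 0) (hvne : ∀ j k, j ≠ k → sFun α (v j - v k) ≠ 0)
    (hwne : ∀ j k, j ≠ k → sFun α (w j - w k) ≠ 0) :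
    ∑ m, coeffA3 α m v * ∏ l, 2 * cosh (Real.pi * (v m + w l - I * α / 4 + d) / α) *
        (2 * cosh (Real.pi * (v m + w l - I * α / 4 - d) / α)) =
      ∑ m, coeffA3 α m w * ∏ l, 2 * cosh (Real.pi * (w m + v l - I * α / 4 + d) / α) *
        (2 * cosh (Real.pi * (w m + v l - I * α / 4 - d) / α)) := by
  have hAB : -I * exp (2 * Real.pi * d / α) * (-I * (exp (2 * Real.pi * d / α))⁻¹) = -1 := by
    have := exp_ne_zero (2 * Real.pi * d / α)
    field_simp
    simp
  have hne : ∀ u : Fin 4 → ℂ, (∀ j k, j ≠ k → sFun α (u j - u k) ≠ 0) → ∀ j k, j ≠ k →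
      exp (Real.pi * u j / α) ^ 2 - exp (Real.pi * u k / α) ^ 2 ≠ 0 := by
    intro u hu j k hjk h
    exact hu j k hjk (by rw [sFun_sub, h, zero_div])
  have hone : ∀ u : Fin 4 → ℂ, ∑ j, u j = 0 → exp (Real.pi * u 0 / α) ^ 2 *
      exp (Real.pi * u 1 / α) ^ 2 * exp (Real.pi * u 2 / α) ^ 2 * exp (Real.pi * u 3 / α) ^ 2 = 1 := by
    intro u hu
    rw [← mul_pow, ← mul_pow, ← mul_pow, prod_exp_eq_one hu, one_pow]
  rw [Finset.sum_congr rfl fun m _ => coeffA3_mul_prod hα d hv hw m,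
    Finset.sum_congr rfl fun m _ => coeffA3_mul_prod hα d hw hv m]
  rw [rational_sum_eq (fun j => exp (Real.pi * v j / α) ^ 2) (fun j => exp (Real.pi * w j / α) ^ 2)
      (hne v hvne) (hone v hv) (hone w hw) hAB,
    rational_sum_eq (fun j => exp (Real.pi * w j / α) ^ 2) (fun j => exp (Real.pi * v j / α) ^ 2)
      (hne w hwne) (hone w hw) (hone v hv) hAB]
  ring

/-! ### Reduction of the kernel identity to the hyperbolic identity -/

/-- The kernel identity for the product of values of any function that satisfies the first order
difference equation of the hyperbolic gamma function at the relevant points. -/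
theorem kernel_identity_of_difference_equation {α β : ℝ} (hα : α ≠ 0) (G : ℂ → ℂ) (d s : ℂ)
    (hs : s = I * (α + β) / 4) {v w : Fin 4 → ℂ} (hv : ∑ j, v j = 0)
    (hw : ∑ j, w j = 0) (hvne : ∀ j k, j ≠ k → sFun α (v j - v k) ≠ 0)
    (hwne : ∀ j k, j ≠ k → sFun α (w j - w k) ≠ 0)
    (hadd : ∀ k l, G (v k + w l - s - I * β / 4 + d + I * β) =
      2 * cosh (Real.pi * (v k + w l - s - I * β / 4 + d + I * β / 2) / α) *
        G (v k + w l - s - I * β / 4 + d))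
    (hsub : ∀ k l, G (v k + w l - s - I * β / 4 - d + I * β) =
      2 * cosh (Real.pi * (v k + w l - s - I * β / 4 - d + I * β / 2) / α) *
        G (v k + w l - s - I * β / 4 - d)) :
    opA3 α β (fun x => ∏ k, ∏ l, G (x k + w l - s + d) * G (x k + w l - s - d)) v =
      opA3 α β (fun x => ∏ k, ∏ l, G (v k + x l - s + d) * G (v k + x l - s - d)) w := by
  -- The product of all `H k l` is common to all eight summands.
  set H : Fin 4 → Fin 4 → ℂ := fun k l =>
    G (v k + w l - s - I * β / 4 + d) * G (v k + w l - s - I * β / 4 - d) with hH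
  set C : Fin 4 → Fin 4 → ℂ := fun k l => 2 * cosh (Real.pi * (v k + w l - I * α / 4 + d) / α) *
    (2 * cosh (Real.pi * (v k + w l - I * α / 4 - d) / α)) with hC
  have hshift : ∀ k l, G (v k + w l - s + d + 3 * (I * β / 4)) *
      G (v k + w l - s - d + 3 * (I * β / 4)) = C k l * H k l := by
    intro k l
    have e1 : v k + w l - s + d + 3 * (I * β / 4) = v k + w l - s - I * β / 4 + d + I * β := by ring
    have e2 : v k + w l - s - d + 3 * (I * β / 4) = v k + w l - s - I * β / 4 - d + I * β := by ring
    -- At the midpoint of the step `β` drops out: `-i(α+β)/4 - iβ/4 + iβ/2 = -iα/4`.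
    have e3 : v k + w l - s - I * β / 4 + d + I * β / 2 = v k + w l - I * α / 4 + d := by
      rw [hs]; ring
    have e4 : v k + w l - s - I * β / 4 - d + I * β / 2 = v k + w l - I * α / 4 - d := by
      rw [hs]; ring
    rw [e1, e2, hadd, hsub, e3, e4]
    simp only [hC, hH]
    ring
  have hleft : ∀ m, (∏ k, ∏ l, G (shiftA3 β m v k + w l - s + d) * G (shiftA3 β m v k + w l - s - d)) =
      (∏ l, C m l) * ∏ k, ∏ l, H k l := by
    intro m
    have : ∀ k, (∏ l, G (shiftA3 β m v k + w l - s + d) * G (shiftA3 β m v k + w l - s - d)) =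
        (if k = m then ∏ l, C m l else 1) * ∏ l, H k l := by
      intro k
      by_cases hk : k = m
      · subst hk
        rw [if_pos rfl, ← Finset.prod_mul_distrib]
        refine Finset.prod_congr rfl fun l _ => ?_
        rw [← hshift, shiftA3, if_pos rfl]
        congr 2 <;> ring
      · rw [if_neg hk, one_mul]
        refine Finset.prod_congr rfl fun l _ => ?_
        rw [shiftA3, if_neg hk]
        simp only [hH]
        congr 2 <;> ring
    rw [Finset.prod_congr rfl fun k _ => this k, Finset.prod_mul_distrib, Finset.prod_ite_eq']
    simp
  have hright : ∀ m, (∏ k, ∏ l, G (v k + shiftA3 β m w l - s + d) * G (v k + shiftA3 β m w l - s - d)) =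
      (∏ k, C k m) * ∏ k, ∏ l, H k l := by
    intro m
    have : ∀ l, (∏ k, G (v k + shiftA3 β m w l - s + d) * G (v k + shiftA3 β m w l - s - d)) =
        (if l = m then ∏ k, C k m else 1) * ∏ k, H k l := by
      intro l
      by_cases hl : l = m
      · subst hl
        rw [if_pos rfl, ← Finset.prod_mul_distrib]
        refine Finset.prod_congr rfl fun k _ => ?_
        rw [← hshift, shiftA3, if_pos rfl]
        congr 2 <;> ring
      · rw [if_neg hl, one_mul]
        refine Finset.prod_congr rfl fun k _ => ?_
        rw [shiftA3, if_neg hl]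
        simp only [hH]
        congr 2 <;> ring
    rw [Finset.prod_comm, Finset.prod_congr rfl fun k _ => this k, Finset.prod_mul_distrib,
      Finset.prod_ite_eq', Finset.prod_comm (f := H)]
    simp
  simp only [opA3, hleft, hright, ← mul_assoc, ← Finset.sum_mul]
  have key := hyperbolic_identity hα d hv hw hvne hwne
  simp only [hC]
  rw [key]
  congr 1
  refine Finset.sum_congr rfl fun m _ => ?_
  congr 1
  refine Finset.prod_congr rfl fun l _ => ?_
  rw [add_comm (w m)]

open MeasureTheory Set Filter Topology

/-! ### Convergence and continuity of the defining integral -/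

/-- The integrand of `gammaPhase`. -/
def gammaIntegrand (aP aM : ℝ) (z : ℂ) (y : ℝ) : ℂ :=
  (1 / (y : ℂ)) * (sin (2 * y * z) / (2 * sinh (aP * y) * sinh (aM * y)) - z / (aP * aM * y))

theorem gammaPhase_eq (aP aM : ℝ) (z : ℂ) :
    gammaPhase aP aM z = ∫ y in Ioi (0 : ℝ), gammaIntegrand aP aM z y := rfl

theorem norm_sinh_sub_self_le (w : ℂ) : ‖sinh w - w‖ ≤ ‖w‖ ^ 3 * Real.exp ‖w‖ := by
  have h1 := norm_exp_sub_sum_le_norm_mul_exp w 3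
  have h2 := norm_exp_sub_sum_le_norm_mul_exp (-w) 3
  rw [norm_neg] at h2
  have h : sinh w - w = ((exp w - ∑ m ∈ Finset.range 3, w ^ m / m.factorial) -
      (exp (-w) - ∑ m ∈ Finset.range 3, (-w) ^ m / m.factorial)) / 2 := by
    simp [Finset.sum_range_succ, sinh]
    ring
  rw [h, norm_div, Complex.norm_two]
  have := norm_sub_le (exp w - ∑ m ∈ Finset.range 3, w ^ m / m.factorial)
    (exp (-w) - ∑ m ∈ Finset.range 3, (-w) ^ m / m.factorial)
  linarith

theorem norm_sin_sub_self_le (w : ℂ) : ‖sin w - w‖ ≤ ‖w‖ ^ 3 * Real.exp ‖w‖ := by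
  have h := norm_sinh_sub_self_le (w * I)
  rw [sinh_mul_I, ← sub_mul, norm_mul, norm_mul, norm_I, mul_one, mul_one] at h
  exact h

theorem real_sinh_sub_self_le {x : ℝ} (hx : 0 ≤ x) :
    Real.sinh x - x ≤ x ^ 3 * Real.exp x := by
  have h := norm_sinh_sub_self_le (x : ℂ)
  rw [← ofReal_sinh, ← ofReal_sub, norm_real, norm_real, Real.norm_of_nonneg hx] at h
  exact (le_abs_self _).trans h

theorem norm_sin_le_exp (w : ℂ) : ‖sin w‖ ≤ Real.exp |w.im| := by
  have h : ‖sin w‖ ≤ (‖exp (-w * I)‖ + ‖exp (w * I)‖) / 2 := by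
    rw [sin, norm_div, norm_mul, norm_I, mul_one, Complex.norm_two]
    gcongr
    exact norm_sub_le _ _
  refine h.trans ?_
  rw [norm_exp, norm_exp]
  have h1 : (-w * I).re = w.im := by simp
  have h2 : (w * I).re = -w.im := by simp
  rw [h1, h2]
  have := Real.exp_le_exp.2 (le_abs_self w.im)
  have := Real.exp_le_exp.2 (neg_le_abs w.im)
  linarith

theorem mul_exp_le_sinh {a y : ℝ} (ha : 0 < a) (hy : 1 ≤ y) :
    (1 - Real.exp (-2 * a)) / 2 * Real.exp (a * y) ≤ Real.sinh (a * y) := by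
  rw [Real.sinh_eq]
  have h : Real.exp (-(a * y)) ≤ Real.exp (-2 * a) * Real.exp (a * y) := by
    rw [← Real.exp_add]
    apply Real.exp_le_exp.2
    nlinarith
  linarith

/-- For `p = a₊y` and `q = a₋y` the bound stays finite as `y → 0`, although both terms on the left
grow like `1/y²`. -/
theorem abs_inv_sinh_mul_sinh_sub_le {p q : ℝ} (hp : 0 < p) (hq : 0 < q) :
    |1 / (Real.sinh p * Real.sinh q) - 1 / (p * q)| ≤
      p / q * Real.exp p + q / p * Real.exp q := by
  have hsp : p ≤ Real.sinh p := Real.self_le_sinh_iff.2 hp.le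
  have hsq : q ≤ Real.sinh q := Real.self_le_sinh_iff.2 hq.le
  have h1 := real_sinh_sub_self_le hp.le
  have h2 := real_sinh_sub_self_le hq.le
  set s := Real.sinh p
  set t := Real.sinh q
  have hs : 0 < s := hp.trans_le hsp
  have ht : 0 < t := hq.trans_le hsq
  have e : 1 / (s * t) - 1 / (p * q) = -((s - p) / (s * p * q) + (t - q) / (s * t * q)) := by
    field_simp
    ring
  have b1 : (s - p) / (s * p * q) ≤ p / q * Real.exp p := by
    calc (s - p) / (s * p * q) ≤ p ^ 3 * Real.exp p / (p * p * q) := by gcongr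
      _ = _ := by field_simp
  have b2 : (t - q) / (s * t * q) ≤ q / p * Real.exp q := by
    calc (t - q) / (s * t * q) ≤ q ^ 3 * Real.exp q / (p * q * q) := by gcongr
      _ = _ := by field_simp
  have b3 : 0 ≤ (s - p) / (s * p * q) := div_nonneg (by linarith) (by positivity)
  have b4 : 0 ≤ (t - q) / (s * t * q) := div_nonneg (by linarith) (by positivity)
  rw [e, abs_neg, abs_of_nonneg (by positivity)]
  linarith

theorem sinh_ofReal_mul_ne_zero {a y : ℝ} (ha : 0 < a) (hy : 0 < y) :
    sinh ((a : ℂ) * y) ≠ 0 := by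
  rw [← ofReal_mul, ← ofReal_sinh]
  exact_mod_cast (Real.sinh_pos_iff.2 (mul_pos ha hy)).ne'

theorem gammaIntegrand_le_near_zero {aP aM R : ℝ} (hP : 0 < aP) (hM : 0 < aM) {z : ℂ}
    (hz : ‖z‖ ≤ R) {y : ℝ} (hy : 0 < y) (hy1 : y ≤ 1) :
    ‖gammaIntegrand aP aM z y‖ ≤ 4 * R ^ 3 * Real.exp (2 * R) / (aP * aM) +
      R * (aP / aM * Real.exp aP + aM / aP * Real.exp aM) := by
  have hR : 0 ≤ R := (norm_nonneg z).trans hz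
  have hy' : (y : ℂ) ≠ 0 := by exact_mod_cast hy.ne'
  have hP' : (aP : ℂ) ≠ 0 := by exact_mod_cast hP.ne'
  have hM' : (aM : ℂ) ≠ 0 := by exact_mod_cast hM.ne'
  have hsP := sinh_ofReal_mul_ne_zero hP hy
  have hsM := sinh_ofReal_mul_ne_zero hM hy
  -- The linear part of the sine is paired with the subtracted term, so that the `1/y²`
  -- singularities cancel.
  have e : gammaIntegrand aP aM z y =
      (sin (2 * y * z) - 2 * y * z) / (2 * y * (sinh (aP * y) * sinh (aM * y))) +
      z * ((1 / (Real.sinh (aP * y) * Real.sinh (aM * y)) - 1 / (aP * y * (aM * y)) : ℝ) : ℂ) := by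
    push_cast
    rw [gammaIntegrand]
    field_simp
    ring
  rw [e]
  refine (norm_add_le _ _).trans (add_le_add ?_ ?_)
  · have hw : ‖(2 * y * z : ℂ)‖ ≤ 2 * y * R := by
      rw [norm_mul, norm_mul, norm_real, Real.norm_of_nonneg hy.le, Complex.norm_two]
      gcongr
    have h1 : ‖sin (2 * y * z) - 2 * y * z‖ ≤ (2 * y * R) ^ 3 * Real.exp (2 * R) := by
      refine (norm_sin_sub_self_le _).trans ?_
      gcongr
      nlinarith
    have h2 : 2 * y * (aP * y * (aM * y)) ≤
        ‖(2 * y * (sinh (aP * y) * sinh (aM * y)) : ℂ)‖ := by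
      rw [← ofReal_mul, ← ofReal_mul, ← ofReal_sinh, ← ofReal_sinh, norm_mul, norm_mul, norm_mul,
        norm_real, norm_real, norm_real, Complex.norm_two, Real.norm_of_nonneg hy.le,
        Real.norm_of_nonneg (Real.sinh_nonneg_iff.2 (by positivity)),
        Real.norm_of_nonneg (Real.sinh_nonneg_iff.2 (by positivity))]
      have := Real.self_le_sinh_iff.2 (mul_pos hP hy).le
      have := Real.self_le_sinh_iff.2 (mul_pos hM hy).le
      gcongr
    rw [norm_div]
    calc _ ≤ (2 * y * R) ^ 3 * Real.exp (2 * R) / (2 * y * (aP * y * (aM * y))) := by gcongr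
      _ = _ := by field_simp; ring
  · rw [norm_mul, norm_real, Real.norm_eq_abs]
    refine mul_le_mul hz ?_ (abs_nonneg _) hR
    refine (abs_inv_sinh_mul_sinh_sub_le (mul_pos hP hy) (mul_pos hM hy)).trans ?_
    have e1 : aP * y / (aM * y) = aP / aM := by field_simp
    have e2 : aM * y / (aP * y) = aM / aP := by field_simp
    rw [e1, e2]
    gcongr <;> nlinarith

theorem gammaIntegrand_le_at_infinity {aP aM R b : ℝ} (hP : 0 < aP) (hM : 0 < aM) {z : ℂ}
    (hz : ‖z‖ ≤ R) (hb : |z.im| ≤ b) {y : ℝ} (hy : 1 < y) :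
    ‖gammaIntegrand aP aM z y‖ ≤
      2 / ((1 - Real.exp (-2 * aP)) * (1 - Real.exp (-2 * aM))) *
          Real.exp (-(aP + aM - 2 * b) * y) + R / (aP * aM) * y ^ (-2 : ℝ) := by
  have hy0 : 0 < y := by linarith
  have hcP : 0 < 1 - Real.exp (-2 * aP) := by
    have := Real.exp_lt_one_iff.2 (show -2 * aP < 0 by linarith); linarith
  have hcM : 0 < 1 - Real.exp (-2 * aM) := by
    have := Real.exp_lt_one_iff.2 (show -2 * aM < 0 by linarith); linarith
  have h1 : ‖sin (2 * y * z) / (2 * sinh (aP * y) * sinh (aM * y))‖ ≤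
      2 / ((1 - Real.exp (-2 * aP)) * (1 - Real.exp (-2 * aM))) *
          Real.exp (-(aP + aM - 2 * b) * y) := by
    have hs : ‖sin (2 * y * z)‖ ≤ Real.exp (2 * y * b) := by
      refine (norm_sin_le_exp _).trans (Real.exp_le_exp.2 ?_)
      have : (2 * y * z : ℂ).im = 2 * y * z.im := by
        rw [← ofReal_ofNat, ← ofReal_mul, im_ofReal_mul]
      rw [this, abs_mul, abs_of_pos (by positivity)]
      gcongr
    have hd : 2 * ((1 - Real.exp (-2 * aP)) / 2 * Real.exp (aP * y)) *
        ((1 - Real.exp (-2 * aM)) / 2 * Real.exp (aM * y)) ≤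
        ‖(2 * sinh (aP * y) * sinh (aM * y) : ℂ)‖ := by
      rw [← ofReal_mul, ← ofReal_mul, ← ofReal_sinh, ← ofReal_sinh, norm_mul, norm_mul,
        norm_real, norm_real, Complex.norm_two,
        Real.norm_of_nonneg (Real.sinh_nonneg_iff.2 (by positivity)),
        Real.norm_of_nonneg (Real.sinh_nonneg_iff.2 (by positivity))]
      have := mul_exp_le_sinh hP hy.le
      have := mul_exp_le_sinh hM hy.le
      gcongr
    rw [norm_div]
    calc _ ≤ Real.exp (2 * y * b) / (2 * ((1 - Real.exp (-2 * aP)) / 2 * Real.exp (aP * y)) *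
        ((1 - Real.exp (-2 * aM)) / 2 * Real.exp (aM * y))) := by gcongr
      _ = _ := by
        have : Real.exp (-(aP + aM - 2 * b) * y) =
            Real.exp (2 * y * b) / (Real.exp (aP * y) * Real.exp (aM * y)) := by
          rw [← Real.exp_add, ← Real.exp_sub]; ring_nf
        rw [this]
        field_simp
  have h2 : ‖z / (aP * aM * y)‖ ≤ R / (aP * aM * y) := by
    rw [norm_div, ← ofReal_mul, ← ofReal_mul, norm_real, Real.norm_of_nonneg (by positivity)]
    gcongr
  rw [gammaIntegrand, norm_mul, norm_div, norm_one, norm_real, Real.norm_of_nonneg hy0.le]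
  have h3 : 1 / y ≤ 1 := by rw [div_le_one hy0]; exact hy.le
  calc _ ≤ 1 / y * (_ + _) := by gcongr; exact norm_sub_le _ _
    _ = 1 / y * ‖sin (2 * y * z) / (2 * sinh (aP * y) * sinh (aM * y))‖ +
        1 / y * ‖z / (aP * aM * y)‖ := mul_add _ _ _
    _ ≤ 1 * (2 / ((1 - Real.exp (-2 * aP)) * (1 - Real.exp (-2 * aM))) *
          Real.exp (-(aP + aM - 2 * b) * y)) + 1 / y * (R / (aP * aM * y)) := by
        gcongr
    _ = _ := by
        rw [one_mul, Real.rpow_neg hy0.le, Real.rpow_two]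
        field_simp

/-- The bound is uniform on bounded parts of a closed substrip, as dominated convergence needs for
continuity in `z`. -/
theorem exists_integrable_bound_gammaIntegrand {aP aM R b : ℝ} (hP : 0 < aP) (hM : 0 < aM)
    (hb : b < (aP + aM) / 2) : ∃ bound : ℝ → ℝ, IntegrableOn bound (Ioi 0) ∧
      ∀ z : ℂ, ‖z‖ ≤ R → |z.im| ≤ b → ∀ y, 0 < y → ‖gammaIntegrand aP aM z y‖ ≤ bound y := by
  set K := 4 * R ^ 3 * Real.exp (2 * R) / (aP * aM) +
      R * (aP / aM * Real.exp aP + aM / aP * Real.exp aM)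
  set g : ℝ → ℝ := fun y => 2 / ((1 - Real.exp (-2 * aP)) * (1 - Real.exp (-2 * aM))) *
          Real.exp (-(aP + aM - 2 * b) * y) + R / (aP * aM) * y ^ (-2 : ℝ)
  refine ⟨fun y => if y ≤ 1 then K else g y, ?_, ?_⟩
  · rw [← Ioc_union_Ioi_eq_Ioi zero_le_one]
    refine IntegrableOn.union ?_ ?_
    · refine (integrableOn_const (C := K) (by simp)).congr_fun ?_ measurableSet_Ioc
      intro y hy
      exact (if_pos hy.2).symm
    · have : IntegrableOn g (Ioi 1) :=
        ((exp_neg_integrableOn_Ioi 1 (by linarith)).const_mul _).add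
          ((integrableOn_Ioi_rpow_of_lt (by norm_num) one_pos).const_mul _)
      refine this.congr_fun ?_ measurableSet_Ioi
      intro y hy
      exact (if_neg (not_le.2 hy)).symm
  · intro z hz hzb y hy
    by_cases h : y ≤ 1
    · simpa only [if_pos h] using gammaIntegrand_le_near_zero hP hM hz hy h
    · simpa only [if_neg h] using gammaIntegrand_le_at_infinity hP hM hz hzb (not_le.1 h)

theorem aestronglyMeasurable_gammaIntegrand {aP aM : ℝ} (hP : 0 < aP) (hM : 0 < aM) (z : ℂ) :
    AEStronglyMeasurable (gammaIntegrand aP aM z) (volume.restrict (Ioi 0)) := by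
  refine ContinuousOn.aestronglyMeasurable ?_ measurableSet_Ioi
  intro y hy
  have hy' : (y : ℂ) ≠ 0 := by exact_mod_cast (ne_of_gt hy)
  have hP' : (aP : ℂ) ≠ 0 := by exact_mod_cast hP.ne'
  have hM' : (aM : ℂ) ≠ 0 := by exact_mod_cast hM.ne'
  have hsP := sinh_ofReal_mul_ne_zero hP hy
  have hsM := sinh_ofReal_mul_ne_zero hM hy
  apply ContinuousAt.continuousWithinAt
  unfold gammaIntegrand
  fun_prop (disch := simp [*])

theorem integrableOn_gammaIntegrand {aP aM : ℝ} (hP : 0 < aP) (hM : 0 < aM) {z : ℂ}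
    (hz : |z.im| < (aP + aM) / 2) : IntegrableOn (gammaIntegrand aP aM z) (Ioi 0) := by
  obtain ⟨bound, hi, hb⟩ := exists_integrable_bound_gammaIntegrand (R := ‖z‖) hP hM hz
  refine Integrable.mono' hi (aestronglyMeasurable_gammaIntegrand hP hM z) ?_
  filter_upwards [ae_restrict_mem measurableSet_Ioi] with y hy
  exact hb z le_rfl le_rfl y hy

theorem continuousAt_gammaPhase {aP aM : ℝ} (hP : 0 < aP) (hM : 0 < aM) {z : ℂ}
    (hz : |z.im| < (aP + aM) / 2) : ContinuousAt (gammaPhase aP aM) z := by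
  obtain ⟨b, hzb, hb⟩ := exists_between hz
  obtain ⟨bound, hi, hbd⟩ := exists_integrable_bound_gammaIntegrand (R := ‖z‖ + 1) hP hM hb
  refine continuousAt_of_dominated (bound := bound) (F := gammaIntegrand aP aM)
    (Eventually.of_forall fun x => aestronglyMeasurable_gammaIntegrand hP hM x) ?_ hi ?_
  · have h1 : ∀ᶠ x : ℂ in 𝓝 z, ‖x‖ < ‖z‖ + 1 :=
      continuous_norm.continuousAt.eventually_lt continuousAt_const (by linarith)
    have h2 : ∀ᶠ x : ℂ in 𝓝 z, |x.im| < b :=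
      (continuous_abs.comp continuous_im).continuousAt.eventually_lt continuousAt_const hzb
    filter_upwards [h1, h2] with x hx1 hx2
    filter_upwards [ae_restrict_mem measurableSet_Ioi] with y hy
    exact hbd x hx1.le hx2.le y hy
  · refine Eventually.of_forall fun y => ?_
    unfold gammaIntegrand
    fun_prop

theorem gammaPhase_comm (aP aM : ℝ) (z : ℂ) : gammaPhase aP aM z = gammaPhase aM aP z := by
  simp only [gammaPhase]
  congr 1
  ext y
  ring_nf

theorem gammaPhase_neg (aP aM : ℝ) (z : ℂ) : gammaPhase aP aM (-z) = -gammaPhase aP aM z := by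
  simp only [gammaPhase]
  rw [← integral_neg]
  congr 1
  ext y
  rw [mul_neg, sin_neg]
  ring

/-! ### The integral representation of `log (2 cosh (π z))` -/

/-- The integrand in the representation of `log (2 cosh (π z))`. -/
def coshIntegrand (z : ℂ) (y : ℝ) : ℂ := (1 / (y : ℂ)) * (1 / y - cos (2 * y * z) / sinh y)

/-- The integral that represents `log (2 cosh (π z))` for `|Im z| < 1 / 2`. -/
def coshPhase (z : ℂ) : ℂ := ∫ y in Ioi (0 : ℝ), coshIntegrand z y

/-- The derivative of `coshIntegrand` in the complex variable. -/
def tanhIntegrand (z : ℂ) (y : ℝ) : ℂ := 2 * sin (2 * y * z) / sinh y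

theorem sinh_ofReal_ne_zero {y : ℝ} (hy : 0 < y) : sinh (y : ℂ) ≠ 0 := by
  simpa using sinh_ofReal_mul_ne_zero one_pos hy

/-- In `sin (A + B) - sin (A - B) = 2 cos A sin B` the factor `sin (icy) = i sinh (cy)` cancels the
denominator containing `c`; scaling by `a` does the rest. -/
theorem gammaIntegrand_sub {a c : ℝ} (ha : 0 < a) (hc : 0 < c) (z : ℂ) {y : ℝ} (hy : 0 < y) :
    I * (gammaIntegrand a c (z + I * c / 2) y - gammaIntegrand a c (z - I * c / 2) y) =
      a * coshIntegrand (z / a) (a * y) := by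
  have hy' : (y : ℂ) ≠ 0 := by exact_mod_cast hy.ne'
  have ha' : (a : ℂ) ≠ 0 := by exact_mod_cast ha.ne'
  have hc' : (c : ℂ) ≠ 0 := by exact_mod_cast hc.ne'
  have hsa := sinh_ofReal_mul_ne_zero ha hy
  have hsc := sinh_ofReal_mul_ne_zero hc hy
  have e1 : 2 * y * (z + I * c / 2) = 2 * y * z + c * y * I := by ring
  have e2 : 2 * y * (z - I * c / 2) = 2 * y * z - c * y * I := by ring
  have e3 : 2 * (a * y) * (z / a) = 2 * y * z := by field_simp
  rw [gammaIntegrand, gammaIntegrand, coshIntegrand, e1, e2, ofReal_mul, e3, sin_add, sin_sub,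
    cos_mul_I, sin_mul_I]
  generalize sinh ((a : ℂ) * y) = S at hsa ⊢
  generalize sinh ((c : ℂ) * y) = T at hsc ⊢
  field_simp
  ring_nf
  simp only [I_sq]
  ring

theorem integrableOn_coshIntegrand {z : ℂ} (hz : |z.im| < 1 / 2) :
    IntegrableOn (coshIntegrand z) (Ioi 0) := by
  have hz' := abs_lt.1 hz
  have h1 : |(z + I * (1 : ℝ) / 2).im| < (1 + 1) / 2 := by
    have : (z + I * (1 : ℝ) / 2).im = z.im + 1 / 2 := by simp
    rw [this, abs_lt]; constructor <;> linarith
  have h2 : |(z - I * (1 : ℝ) / 2).im| < (1 + 1) / 2 := by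
    have : (z - I * (1 : ℝ) / 2).im = z.im - 1 / 2 := by simp
    rw [this, abs_lt]; constructor <;> linarith
  have := ((integrableOn_gammaIntegrand one_pos one_pos h1).sub
    (integrableOn_gammaIntegrand one_pos one_pos h2)).const_mul I
  refine IntegrableOn.congr_fun this ?_ measurableSet_Ioi
  intro y hy
  simpa using gammaIntegrand_sub one_pos one_pos z hy

theorem gammaPhase_sub {a c : ℝ} (ha : 0 < a) (hc : 0 < c) {z : ℂ} (hz : |z.im| < a / 2) :
    I * (gammaPhase a c (z + I * c / 2) - gammaPhase a c (z - I * c / 2)) = coshPhase (z / a) := by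
  have hz' := abs_lt.1 hz
  have h1 : |(z + I * c / 2).im| < (a + c) / 2 := by
    have : (z + I * c / 2).im = z.im + c / 2 := by simp
    rw [this, abs_lt]; constructor <;> linarith
  have h2 : |(z - I * c / 2).im| < (a + c) / 2 := by
    have : (z - I * c / 2).im = z.im - c / 2 := by simp
    rw [this, abs_lt]; constructor <;> linarith
  rw [gammaPhase_eq, gammaPhase_eq, ← integral_sub (integrableOn_gammaIntegrand ha hc h1)
    (integrableOn_gammaIntegrand ha hc h2), ← integral_const_mul,
    setIntegral_congr_fun measurableSet_Ioi fun y hy => gammaIntegrand_sub ha hc z hy,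
    integral_const_mul, integral_comp_mul_left_Ioi _ _ ha, mul_zero, coshPhase, real_smul,
    ← mul_assoc, ofReal_inv, mul_inv_cancel₀ (by exact_mod_cast ha.ne'), one_mul]

/-- At `z = i/4` the cosine becomes `cosh (y/2)`, which cancels against `sinh y = 2 sinh (y/2) cosh
(y/2)`; substituting `y/2` gives the integrand at 0. This relation fixes the constant in
`exp_coshPhase`. -/
theorem two_mul_coshPhase_I_div_four : 2 * coshPhase (I / 4) = coshPhase 0 := by
  have h : ∀ y ∈ Ioi (0 : ℝ), 2 * coshIntegrand (I / 4) y =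
      (1 / 2) * coshIntegrand 0 ((1 / 2 : ℝ) * y) := by
    intro y hy
    have hy' : (y : ℂ) ≠ 0 := by exact_mod_cast (ne_of_gt hy)
    have hs : sinh (y / 2 : ℂ) ≠ 0 := by
      have := sinh_ofReal_ne_zero (half_pos hy)
      simpa using this
    have hc : cosh (y / 2 : ℂ) ≠ 0 := by
      have := (Real.cosh_pos (y / 2)).ne'
      have h2 : ((Real.cosh (y / 2) : ℝ) : ℂ) ≠ 0 := by exact_mod_cast this
      simpa using h2
    have e1 : 2 * (y : ℂ) * (I / 4) = y / 2 * I := by ring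
    have e2 : sinh (y : ℂ) = 2 * sinh (y / 2) * cosh (y / 2) := by
      rw [← sinh_two_mul]; congr 1; ring
    have e3 : ((1 / 2 : ℝ) * y : ℝ) = (y / 2 : ℂ) := by push_cast; ring
    rw [coshIntegrand, coshIntegrand, e1, e2, e3, cos_mul_I, mul_zero, cos_zero]
    field_simp
  rw [coshPhase, ← integral_const_mul, setIntegral_congr_fun measurableSet_Ioi h,
    integral_const_mul, integral_comp_mul_left_Ioi _ _ (by norm_num), mul_zero, coshPhase,
    real_smul, ← mul_assoc]
  norm_num

/-! ### Differentiation of `coshPhase` under the integral sign -/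

theorem exists_integrable_bound_tanhIntegrand {R b : ℝ} (hb : b < 1 / 2) :
    ∃ bound : ℝ → ℝ, IntegrableOn bound (Ioi 0) ∧
      ∀ z : ℂ, ‖z‖ ≤ R → |z.im| ≤ b → ∀ y, 0 < y → ‖tanhIntegrand z y‖ ≤ bound y := by
  set K := 2 * (2 * R + 8 * R ^ 3 * Real.exp (2 * R))
  set c := (1 - Real.exp (-2 * 1)) / 2 with hc
  have hcpos : 0 < c := by
    have := Real.exp_lt_one_iff.2 (show -2 * (1 : ℝ) < 0 by norm_num)
    exact half_pos (sub_pos.2 this)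
  set g : ℝ → ℝ := fun y => 2 / c * Real.exp (-(1 - 2 * b) * y)
  refine ⟨fun y => if y ≤ 1 then K else g y, ?_, ?_⟩
  · rw [← Ioc_union_Ioi_eq_Ioi zero_le_one]
    refine IntegrableOn.union ?_ ?_
    · refine (integrableOn_const (C := K) (by simp)).congr_fun ?_ measurableSet_Ioc
      intro y hy
      exact (if_pos hy.2).symm
    · have : IntegrableOn g (Ioi 1) := (exp_neg_integrableOn_Ioi 1 (by linarith)).const_mul _
      refine this.congr_fun ?_ measurableSet_Ioi
      intro y hy
      exact (if_neg (not_le.2 hy)).symm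
  · intro z hz hzb y hy
    have hR : 0 ≤ R := (norm_nonneg z).trans hz
    have hs : ‖sinh (y : ℂ)‖ = Real.sinh y := by
      rw [← ofReal_sinh, norm_real, Real.norm_of_nonneg (Real.sinh_nonneg_iff.2 hy.le)]
    rw [tanhIntegrand, norm_div, norm_mul, Complex.norm_two, hs]
    by_cases h : y ≤ 1
    · simp only [if_pos h]
      have hw : ‖(2 * y * z : ℂ)‖ ≤ 2 * y * R := by
        rw [norm_mul, norm_mul, norm_real, Real.norm_of_nonneg hy.le, Complex.norm_two]
        gcongr
      have h1 : ‖sin (2 * y * z) - 2 * y * z‖ ≤ (2 * y * R) ^ 3 * Real.exp (2 * R) := by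
        refine (norm_sin_sub_self_le _).trans ?_
        gcongr
        nlinarith
      have h2 : ‖sin (2 * y * z)‖ ≤ (2 * y * R) ^ 3 * Real.exp (2 * R) + 2 * y * R := by
        have := norm_add_le (sin (2 * y * z) - 2 * y * z) (2 * y * z)
        rw [sub_add_cancel] at this
        linarith
      have h3 : (2 * y * R) ^ 3 * Real.exp (2 * R) + 2 * y * R ≤
          y * (2 * R + 8 * R ^ 3 * Real.exp (2 * R)) := by
        have h4 : y ^ 3 ≤ y := by
          simpa using pow_le_of_le_one hy.le h (three_ne_zero)
        have h5 : 0 ≤ 8 * R ^ 3 * Real.exp (2 * R) := by positivity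
        nlinarith
      have hy2 := Real.self_le_sinh_iff.2 hy.le
      have h6 : 0 ≤ 2 * R + 8 * R ^ 3 * Real.exp (2 * R) := by positivity
      rw [div_le_iff₀ (hy.trans_le hy2)]
      calc 2 * ‖sin (2 * y * z)‖ ≤ 2 * (y * (2 * R + 8 * R ^ 3 * Real.exp (2 * R))) := by linarith
        _ ≤ 2 * (Real.sinh y * (2 * R + 8 * R ^ 3 * Real.exp (2 * R))) := by gcongr
        _ = _ := by ring
    · simp only [if_neg h]
      have h1 := mul_exp_le_sinh one_pos (not_le.1 h).le
      rw [one_mul, ← hc] at h1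
      have h2 : ‖sin (2 * y * z)‖ ≤ Real.exp (2 * y * b) := by
        refine (norm_sin_le_exp _).trans (Real.exp_le_exp.2 ?_)
        have : (2 * y * z : ℂ).im = 2 * y * z.im := by
          rw [← ofReal_ofNat, ← ofReal_mul, im_ofReal_mul]
        rw [this, abs_mul, abs_of_pos (by positivity)]
        gcongr
      calc _ ≤ 2 * Real.exp (2 * y * b) / (c * Real.exp y) := by gcongr
        _ = _ := by
          have : Real.exp (-(1 - 2 * b) * y) = Real.exp (2 * y * b) / Real.exp y := by
            rw [← Real.exp_sub]; ring_nf
          simp only [g]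
          rw [this]
          field_simp

theorem continuousOn_tanhIntegrand (z : ℂ) : ContinuousOn (tanhIntegrand z) (Ioi 0) := by
  intro y hy
  have hs := sinh_ofReal_ne_zero hy
  apply ContinuousAt.continuousWithinAt
  unfold tanhIntegrand
  fun_prop (disch := simp [*])

theorem continuousOn_coshIntegrand (z : ℂ) : ContinuousOn (coshIntegrand z) (Ioi 0) := by
  intro y hy
  have hs := sinh_ofReal_ne_zero hy
  have hy' : (y : ℂ) ≠ 0 := by exact_mod_cast (ne_of_gt hy)
  apply ContinuousAt.continuousWithinAt
  unfold coshIntegrand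
  fun_prop (disch := simp [*])

theorem hasDerivAt_coshIntegrand (z : ℂ) {y : ℝ} (hy : 0 < y) :
    HasDerivAt (fun z => coshIntegrand z y) (tanhIntegrand z y) z := by
  have hs := sinh_ofReal_ne_zero hy
  have hy' : (y : ℂ) ≠ 0 := by exact_mod_cast hy.ne'
  have h1 : HasDerivAt (fun z : ℂ => 2 * (y : ℂ) * z) (2 * y) z := by
    simpa using (hasDerivAt_id z).const_mul (2 * (y : ℂ))
  have h2 := ((h1.ccos.div_const (sinh (y : ℂ))).const_sub (1 / (y : ℂ))).const_mul (1 / (y : ℂ))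
  refine h2.congr_deriv ?_
  rw [tanhIntegrand]
  field_simp

theorem hasDerivAt_coshPhase {z : ℂ} (hz : |z.im| < 1 / 2) :
    IntegrableOn (tanhIntegrand z) (Ioi 0) ∧
      HasDerivAt coshPhase (∫ y in Ioi (0 : ℝ), tanhIntegrand z y) z := by
  obtain ⟨b, hzb, hb⟩ := exists_between hz
  obtain ⟨bound, hi, hbd⟩ := exists_integrable_bound_tanhIntegrand (R := ‖z‖ + 1) hb
  have h1 : ∀ᶠ x : ℂ in 𝓝 z, ‖x‖ < ‖z‖ + 1 :=
    continuous_norm.continuousAt.eventually_lt continuousAt_const (by linarith)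
  have h2 : ∀ᶠ x : ℂ in 𝓝 z, |x.im| < b :=
    (continuous_abs.comp continuous_im).continuousAt.eventually_lt continuousAt_const hzb
  refine hasDerivAt_integral_of_dominated_loc_of_deriv_le (h1.and h2)
    (Eventually.of_forall fun x =>
      (continuousOn_coshIntegrand x).aestronglyMeasurable measurableSet_Ioi)
    (integrableOn_coshIntegrand hz)
    ((continuousOn_tanhIntegrand z).aestronglyMeasurable measurableSet_Ioi) (bound := bound) ?_ hi ?_
  · filter_upwards [ae_restrict_mem measurableSet_Ioi] with y hy x hx
    exact hbd x hx.1.le hx.2.le y hy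
  · filter_upwards [ae_restrict_mem measurableSet_Ioi] with y hy x _
    exact hasDerivAt_coshIntegrand x hy

/-! ### The derivative of `coshPhase` by partial fractions -/

theorem integral_sin_mul_exp_neg {c : ℝ} {z : ℂ} (hz : |z.im| < c / 2) :
    IntegrableOn (fun y : ℝ => sin (2 * y * z) * exp (-c * y)) (Ioi 0) ∧
      ∫ y in Ioi (0 : ℝ), sin (2 * y * z) * exp (-c * y) = 2 * z / (c ^ 2 + 4 * z ^ 2) := by
  have hz' := abs_lt.1 hz
  have r1 : (-c - 2 * I * z).re < 0 := by simp; linarith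
  have r2 : (-c + 2 * I * z).re < 0 := by simp; linarith
  have n1 : (c + 2 * I * z) ≠ 0 := by
    intro h
    have := congrArg re h
    simp at this; linarith
  have n2 : (c - 2 * I * z) ≠ 0 := by
    intro h
    have := congrArg re h
    simp at this; linarith
  have e : ∀ y : ℝ, sin (2 * y * z) * exp (-c * y) =
      I / 2 * (exp ((-c - 2 * I * z) * y) - exp ((-c + 2 * I * z) * y)) := by
    intro y
    have e1 : exp ((-c - 2 * I * z) * y) = exp (-(2 * y * z) * I) * exp (-c * y) := by
      rw [← exp_add]; ring_nf
    have e2 : exp ((-c + 2 * I * z) * y) = exp (2 * y * z * I) * exp (-c * y) := by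
      rw [← exp_add]; ring_nf
    rw [e1, e2, sin]
    ring
  have i1 := integrableOn_exp_mul_complex_Ioi r1 0
  have i2 := integrableOn_exp_mul_complex_Ioi r2 0
  simp only [e]
  refine ⟨(i1.sub i2).const_mul _, ?_⟩
  rw [integral_const_mul, integral_sub i1 i2, integral_exp_mul_complex_Ioi r1,
    integral_exp_mul_complex_Ioi r2]
  have n3 : (c : ℂ) ^ 2 + 4 * z ^ 2 = (c + 2 * I * z) * (c - 2 * I * z) := by
    ring_nf; simp only [I_sq]; ring
  have n4 : (-c - 2 * I * z) = -(c + 2 * I * z) := by ring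
  have n5 : (-c + 2 * I * z) = -(c - 2 * I * z) := by ring
  have n6 : 2 * z = -(I / 2) * ((c + 2 * I * z) - (c - 2 * I * z)) := by
    ring_nf; simp only [I_sq]; ring
  rw [n3, n4, n5, n6]
  simp only [ofReal_zero, mul_zero, exp_zero]
  generalize (c + 2 * I * z) = p at n1 ⊢
  generalize (c - 2 * I * z) = q at n2 ⊢
  field_simp
  ring

/-- Splits off one term of `1 / sinh y = 2 ∑ exp (-(2k+1)y)`, keeping an exact remainder that tends
to zero after integration. -/
theorem tanhIntegrand_mul_exp_sub (z : ℂ) (N : ℕ) {y : ℝ} (hy : 0 < y) :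
    tanhIntegrand z y * exp (-(2 * N : ℕ) * y) =
      4 * (sin (2 * y * z) * exp (-(2 * N + 1 : ℝ) * y)) +
        tanhIntegrand z y * exp (-(2 * (N + 1) : ℕ) * y) := by
  have hs := sinh_ofReal_ne_zero hy
  have e1 : exp (-(2 * N : ℕ) * y) = exp (-(2 * N + 1 : ℝ) * y) * exp y := by
    rw [← exp_add]; push_cast; ring_nf
  have e2 : exp (-(2 * (N + 1) : ℕ) * y) = exp (-(2 * N + 1 : ℝ) * y) * exp (-y) := by
    rw [← exp_add]; push_cast; ring_nf
  have e3 : exp (y : ℂ) = 2 * sinh y + exp (-y) := by rw [two_sinh]; ring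
  rw [e1, e2, tanhIntegrand, e3]
  field_simp
  ring

theorem norm_tanhIntegrand_mul_exp_le (z : ℂ) (N : ℕ) {y : ℝ} (hy : 0 < y) :
    ‖tanhIntegrand z y * exp (-(2 * N : ℕ) * y)‖ ≤ ‖tanhIntegrand z y‖ := by
  rw [norm_mul]
  refine mul_le_of_le_one_right (norm_nonneg _) ?_
  rw [norm_exp, Real.exp_le_one_iff]
  have : (-((2 * N : ℕ) : ℂ) * y).re = -((2 * N : ℕ) * y) := by
    rw [← ofReal_natCast, ← ofReal_neg, ← ofReal_mul, ofReal_re]; ring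
  rw [this]
  have := mul_nonneg (Nat.cast_nonneg (α := ℝ) (2 * N)) hy.le
  linarith

theorem integrableOn_tanhIntegrand_mul_exp {z : ℂ} (hz : |z.im| < 1 / 2) (N : ℕ) :
    IntegrableOn (fun y => tanhIntegrand z y * exp (-(2 * N : ℕ) * y)) (Ioi 0) := by
  refine Integrable.mono (hasDerivAt_coshPhase hz).1 ?_ ?_
  · refine ContinuousOn.aestronglyMeasurable ?_ measurableSet_Ioi
    exact (continuousOn_tanhIntegrand z).mul (Continuous.continuousOn (by fun_prop))
  · filter_upwards [ae_restrict_mem measurableSet_Ioi] with y hy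
    exact norm_tanhIntegrand_mul_exp_le z N hy

theorem integral_tanhIntegrand_eq_sum {z : ℂ} (hz : |z.im| < 1 / 2) (N : ℕ) :
    ∫ y in Ioi (0 : ℝ), tanhIntegrand z y =
      ∑ k ∈ Finset.range N, 8 * z / ((2 * k + 1) ^ 2 + 4 * z ^ 2) +
        ∫ y in Ioi (0 : ℝ), tanhIntegrand z y * exp (-(2 * N : ℕ) * y) := by
  induction N with
  | zero => simp
  | succ N ih =>
    have hzN : |z.im| < (2 * N + 1 : ℝ) / 2 := by
      have := Nat.cast_nonneg (α := ℝ) N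
      linarith
    obtain ⟨hi, hv⟩ := integral_sin_mul_exp_neg hzN
    rw [ih, setIntegral_congr_fun measurableSet_Ioi fun y hy => tanhIntegrand_mul_exp_sub z N hy,
      integral_add (hi.const_mul 4) (integrableOn_tanhIntegrand_mul_exp hz (N + 1)),
      integral_const_mul, hv, Finset.sum_range_succ]
    push_cast
    ring

theorem tendsto_sum_tanhIntegrand {z : ℂ} (hz : |z.im| < 1 / 2) :
    Tendsto (fun N : ℕ => ∑ k ∈ Finset.range N, 8 * z / ((2 * k + 1) ^ 2 + 4 * z ^ 2)) atTop
      (𝓝 (∫ y in Ioi (0 : ℝ), tanhIntegrand z y)) := by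
  have h0 : Tendsto (fun N : ℕ => ∫ y in Ioi (0 : ℝ), tanhIntegrand z y * exp (-(2 * N : ℕ) * y))
      atTop (𝓝 (∫ _ in Ioi (0 : ℝ), (0 : ℂ))) := by
    refine tendsto_integral_of_dominated_convergence (fun y => ‖tanhIntegrand z y‖)
      (fun N => (integrableOn_tanhIntegrand_mul_exp hz N).aestronglyMeasurable)
      (hasDerivAt_coshPhase hz).1.norm ?_ ?_
    · intro N
      filter_upwards [ae_restrict_mem measurableSet_Ioi] with y hy
      exact norm_tanhIntegrand_mul_exp_le z N hy
    · filter_upwards [ae_restrict_mem measurableSet_Ioi] with y hy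
      have e : ∀ N : ℕ, exp (-(2 * N : ℕ) * y) = exp (-2 * y) ^ N := by
        intro N
        rw [← exp_nat_mul]; push_cast; ring_nf
      have hlt : ‖exp (-2 * y)‖ < 1 := by
        rw [norm_exp, Real.exp_lt_one_iff]
        simpa using hy
      simp only [e]
      simpa using (tendsto_pow_atTop_nhds_zero_of_norm_lt_one hlt).const_mul (tanhIntegrand z y)
  rw [integral_zero] at h0
  have h1 : ∀ N : ℕ, ∑ k ∈ Finset.range N, 8 * z / ((2 * k + 1) ^ 2 + 4 * z ^ 2) =
      (∫ y in Ioi (0 : ℝ), tanhIntegrand z y) -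
        ∫ y in Ioi (0 : ℝ), tanhIntegrand z y * exp (-(2 * N : ℕ) * y) := by
    intro N
    rw [integral_tanhIntegrand_eq_sum hz N]; ring
  simp only [h1]
  simpa using h0.const_sub (∫ y in Ioi (0 : ℝ), tanhIntegrand z y)

/-- Regroups the cotangent series centred at `1/2 + s` into pairs symmetric about `s`; one boundary
term stays unpaired and vanishes in the limit. -/
theorem cotTerm_sum_eq {s : ℂ} (N : ℕ) :
    1 / (1 / 2 + s) + ∑ j ∈ Finset.range N, cotTerm (1 / 2 + s) j =
      ∑ k ∈ Finset.range N, (1 / (s + k + 1 / 2) + 1 / (s - k - 1 / 2)) + 1 / (1 / 2 + s + N) := by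
  induction N with
  | zero => simp
  | succ N ih =>
    rw [Finset.sum_range_succ, ← add_assoc, ih, Finset.sum_range_succ, cotTerm]
    have e1 : s + N + 1 / 2 = 1 / 2 + s + N := by ring
    have e2 : s - N - 1 / 2 = 1 / 2 + s - (N + 1) := by ring
    rw [e1, e2]
    push_cast
    ring_nf

theorem integral_tanhIntegrand {z : ℂ} (hz : |z.im| < 1 / 2) :
    ∫ y in Ioi (0 : ℝ), tanhIntegrand z y = Real.pi * sinh (Real.pi * z) / cosh (Real.pi * z) := by
  have hz' := abs_lt.1 hz
  refine tendsto_nhds_unique (tendsto_sum_tanhIntegrand hz) ?_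
  -- The shift by 1/2 turns the cotangent into `-tan (πiz) = -i tanh (πz)`. The real part `1/2 - Im
  -- z` lies strictly between 0 and 1.
  have hx : 1 / 2 + z * I ∈ integerComplement := by
    rintro ⟨n, hn⟩
    have := congrArg re hn
    simp at this
    have h0 : (0 : ℝ) < n := by linarith
    have h1 : (n : ℝ) < 1 := by linarith
    have h0' : 0 < n := by exact_mod_cast h0
    have h1' : n < 1 := by exact_mod_cast h1
    omega
  have hlim : Tendsto (fun N : ℕ => 1 / (1 / 2 + z * I + N)) atTop (𝓝 0) := by
    simp only [one_div]
    refine tendsto_inv₀_cobounded.comp ?_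
    exact tendsto_const_add_cobounded _ |>.comp tendsto_natCast_atTop_cobounded
  have h1 := ((tendsto_logDeriv_euler_cot_sub hx).const_add (1 / (1 / 2 + z * I))).sub hlim
  have h2 := h1.const_mul I
  have hcot : I * (1 / (1 / 2 + z * I) +
      (Real.pi * cot (Real.pi * (1 / 2 + z * I)) - 1 / (1 / 2 + z * I)) - 0) =
      Real.pi * sinh (Real.pi * z) / cosh (Real.pi * z) := by
    have e : Real.pi * (1 / 2 + z * I) = Real.pi * z * I + Real.pi / 2 := by ring
    rw [e, cot_eq_cos_div_sin, cos_add_pi_div_two, sin_add_pi_div_two, sin_mul_I, cos_mul_I]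
    ring_nf
    simp only [I_sq]
    ring
  rw [hcot] at h2
  refine h2.congr fun N => ?_
  rw [cotTerm_sum_eq, add_sub_cancel_right, Finset.mul_sum]
  refine Finset.sum_congr rfl fun k _ => ?_
  have hk := Nat.cast_nonneg (α := ℝ) k
  have n1 : z * I + k + 1 / 2 ≠ 0 := by
    intro h
    have := congrArg re h
    simp at this; linarith
  have n2 : z * I - k - 1 / 2 ≠ 0 := by
    intro h
    have := congrArg re h
    simp at this; linarith
  have n3 : ((2 * k + 1) ^ 2 + 4 * z ^ 2 : ℂ) = -4 * ((z * I + k + 1 / 2) * (z * I - k - 1 / 2)) := by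
    ring_nf; simp only [I_sq]; ring
  rw [n3, div_add_div _ _ n1 n2, mul_div_assoc', eq_comm, div_eq_div_iff (mul_ne_zero (by norm_num) (mul_ne_zero n1 n2))
    (mul_ne_zero n1 n2)]
  ring_nf
  simp only [I_sq, I_pow_four]
  ring

theorem cosh_pi_mul_ne_zero {z : ℂ} (hz : |z.im| < 1 / 2) : cosh (Real.pi * z) ≠ 0 := by
  have hz' := abs_lt.1 hz
  rw [← cos_mul_I]
  intro h
  obtain ⟨k, hk⟩ := cos_eq_zero_iff.1 h
  have := congrArg re hk
  have e : ((2 * k + 1) * Real.pi / 2 : ℂ).re = (2 * k + 1) * Real.pi / 2 := by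
    rw [← ofReal_re ((2 * k + 1) * Real.pi / 2)]; push_cast; rfl
  rw [e] at this
  simp [mul_assoc] at this
  have h2 : -z.im = (2 * k + 1) / 2 := by
    have := Real.pi_pos
    apply mul_left_cancel₀ Real.pi_ne_zero
    linarith
  have h3 : (k : ℝ) < 0 := by linarith
  have h4 : (-1 : ℝ) < k := by linarith
  have h3' : k < 0 := by exact_mod_cast h3
  have h4' : -1 < k := by exact_mod_cast h4
  omega

/-- The quotient of the two sides has zero derivative on the convex strip, hence is constant. -/
theorem exp_coshPhase {z : ℂ} (hz : |z.im| < 1 / 2) :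
    exp (coshPhase z) = 2 * cosh (Real.pi * z) := by
  set s : Set ℂ := {z | |z.im| < 1 / 2} with hs
  have hopen : IsOpen s := isOpen_lt (by fun_prop) continuous_const
  have hconv : Convex ℝ s := by
    have : s = imLm ⁻¹' (Ioo (-(1 / 2)) (1 / 2)) := by
      ext x; simp [hs, abs_lt]
    rw [this]
    exact (convex_Ioo _ _).linear_preimage imLm
  have hder : ∀ x ∈ s, HasDerivAt (fun x => exp (-coshPhase x) * cosh (Real.pi * x)) 0 x := by
    intro x hx
    have h1 := (hasDerivAt_coshPhase hx).2
    rw [integral_tanhIntegrand hx] at h1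
    have h2 : HasDerivAt (fun z : ℂ => Real.pi * z) Real.pi x := by
      simpa using (hasDerivAt_id x).const_mul (Real.pi : ℂ)
    refine (h1.fun_neg.cexp.fun_mul h2.ccosh).congr_deriv ?_
    have := cosh_pi_mul_ne_zero hx
    field_simp
    ring
  have hconst : ∀ x ∈ s, cosh (Real.pi * x) = exp (coshPhase x) * exp (-coshPhase 0) := by
    intro x hx
    have := hopen.is_const_of_deriv_eq_zero hconv.isPreconnected
      (fun x hx => (hder x hx).differentiableAt.differentiableWithinAt)
      (fun x hx => (hder x hx).deriv) hx (show (0 : ℂ) ∈ s by simp [hs])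
    simp only [mul_zero, cosh_zero, mul_one] at this
    rw [← this, ← mul_assoc, ← exp_add]
    simp
  -- Squaring the relation at `i/4` gives `cos² (π/4) = exp (2Φ(i/4) - 2Φ(0))` with `Φ = coshPhase`,
  -- and `2Φ(i/4) = Φ(0)` leaves `exp (-Φ(0))`.
  have h4 : exp (-coshPhase 0) = 1 / 2 := by
    have h := hconst (I / 4) (by simp [hs]; norm_num)
    have e : (Real.pi * (I / 4) : ℂ) = (Real.pi / 4 : ℝ) * I := by push_cast; ring
    have h5 : ((Real.cos (Real.pi / 4) ^ 2 : ℝ) : ℂ) = exp (-coshPhase 0) := by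
      rw [e, cosh_mul_I, ← ofReal_cos] at h
      rw [ofReal_pow, h, mul_pow, ← exp_nat_mul, ← exp_nat_mul, ← exp_add]
      congr 1
      push_cast
      rw [two_mul_coshPhase_I_div_four]
      ring
    rw [← h5, Real.cos_pi_div_four, div_pow, Real.sq_sqrt (by norm_num)]
    norm_num
  rw [hconst z hz, h4]
  ring

/-! ### The difference equations of the hyperbolic gamma function -/

theorem exp_gammaPhase_add {a c : ℝ} (ha : 0 < a) (hc : 0 < c) {u : ℂ}
    (hlow : -((a + c) / 2) < u.im) (hup : u.im + c < (a + c) / 2) :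
    exp (I * gammaPhase a c (u + I * c)) =
      2 * cosh (Real.pi * (u + I * c / 2) / a) * exp (I * gammaPhase a c u) := by
  have him : (u + I * c / 2).im = u.im + c / 2 := by simp
  have h1 : |(u + I * c / 2).im| < a / 2 := by
    rw [him, abs_lt]; constructor <;> linarith
  have h2 := gammaPhase_sub ha hc h1
  have h3 : |((u + I * c / 2) / a).im| < 1 / 2 := by
    rw [div_ofReal_im, abs_div, abs_of_pos ha, div_lt_iff₀ ha]
    linarith
  have e1 : u + I * c / 2 + I * c / 2 = u + I * c := by ring
  have e2 : u + I * c / 2 - I * c / 2 = u := by ring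
  rw [e1, e2] at h2
  have h4 := exp_coshPhase h3
  rw [← mul_div_assoc] at h4
  rw [← h4, ← h2, ← exp_add]
  ring_nf

theorem stepCount_add {aP aM t : ℝ} (hM : 0 < aM) (ht : (aP + aM) / 2 ≤ t + aM) :
    stepCount aP aM (t + aM) = stepCount aP aM t + 1 := by
  have h : 0 ≤ (t - (aP + aM) / 2) / aM + 1 := by
    rw [← div_self hM.ne', ← add_div]
    exact div_nonneg (by linarith) hM.le
  rw [stepCount, stepCount, ← Nat.floor_add_one h]
  congr 1
  field_simp
  ring

/-- The sign change interchanges the two step counts and the two products. The identity also holds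
at zeros and poles, since `0⁻¹ = 0`. -/
theorem hyperbolicGamma_neg (aP aM : ℝ) (z : ℂ) :
    hyperbolicGamma aP aM (-z) = (hyperbolicGamma aP aM z)⁻¹ := by
  have h1 : ∀ n m : ℕ, -z - n * (I * aM) + m * (I * aM) = -(z - m * (I * aM) + n * (I * aM)) := by
    intro n m; ring
  have h2 : ∀ c : ℂ, cosh (Real.pi * (-z - c) / aP) = cosh (Real.pi * (z + c) / aP) := by
    intro c
    rw [← cosh_neg]; ring_nf
  have h3 : ∀ c : ℂ, cosh (Real.pi * (-z + c) / aP) = cosh (Real.pi * (z - c) / aP) := by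
    intro c
    rw [← cosh_neg]; ring_nf
  simp only [hyperbolicGamma, neg_im, neg_neg, h1, h2, h3, gammaPhase_neg, mul_neg, exp_neg]
  simp only [div_eq_mul_inv, mul_inv, inv_inv]
  ring

theorem hyperbolicGamma_add_right {aP aM : ℝ} (hP : 0 < aP) (hM : 0 < aM) {u : ℂ}
    (hu : -((aP + aM) / 2) < u.im) :
    hyperbolicGamma aP aM (u + I * aM) =
      2 * cosh (Real.pi * (u + I * aM / 2) / aP) * hyperbolicGamma aP aM u := by
  have him : (u + I * aM).im = u.im + aM := by simp
  rcases lt_or_ge (u.im + aM) ((aP + aM) / 2) with h | h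
  · rw [hyperbolicGamma_eq_exp hM (by rw [him, abs_lt]; constructor <;> linarith),
      hyperbolicGamma_eq_exp hM (by rw [abs_lt]; constructor <;> linarith)]
    exact exp_gammaPhase_add hP hM hu h
  · have h1 : stepCount aP aM (-u.im) = 0 := stepCount_eq_zero hM (by linarith)
    have h2 : stepCount aP aM (-(u.im + aM)) = 0 := stepCount_eq_zero hM (by linarith)
    -- The upward continuation gains one factor. It is the factor of index 0, hence the splitting at
    -- the bottom of the range.
    simp only [hyperbolicGamma, him, h1, h2, stepCount_add hM h, Finset.prod_range_succ',
      Finset.range_zero, Finset.prod_empty, div_one]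
    have e1 : u + I * aM - ((stepCount aP aM u.im + 1 : ℕ) : ℂ) * (I * aM) + ((0 : ℕ) : ℂ) * (I * aM) =
        u - (stepCount aP aM u.im : ℂ) * (I * aM) + ((0 : ℕ) : ℂ) * (I * aM) := by
      push_cast; ring
    have e2 : u + I * aM - (((0 : ℕ) : ℂ) + 1 / 2) * (I * aM) = u + I * aM / 2 := by
      push_cast; ring
    have e3 : ∀ j : ℕ, u + I * aM - (((j + 1 : ℕ) : ℂ) + 1 / 2) * (I * aM) =
        u - ((j : ℂ) + 1 / 2) * (I * aM) := by
      intro j; push_cast; ring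
    simp only [e1, e2, e3]
    ring

theorem continuousAt_hyperbolicGamma {aP aM : ℝ} (hP : 0 < aP) (hM : 0 < aM) {z : ℂ}
    (hz : |z.im| < (aP + aM) / 2) : ContinuousAt (hyperbolicGamma aP aM) z := by
  have h1 : ContinuousAt (fun x => exp (I * gammaPhase aP aM x)) z :=
    (continuousAt_const.mul (continuousAt_gammaPhase hP hM hz)).cexp
  refine h1.congr ?_
  have h2 : ∀ᶠ x : ℂ in 𝓝 z, |x.im| < (aP + aM) / 2 :=
    (continuous_abs.comp continuous_im).continuousAt.eventually_lt continuousAt_const hz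
  filter_upwards [h2] with x hx
  exact (hyperbolicGamma_eq_exp hM hx).symm

/-- Supplies continuity across the line `Im = (a₊ + a₋)/2`, where the exponential formula ends. -/
theorem continuousAt_hyperbolicGamma_add {aP aM : ℝ} (hP : 0 < aP) (hM : 0 < aM) {z : ℂ}
    (hz : |z.im| < (aP + aM) / 2) :
    ContinuousAt (fun x => hyperbolicGamma aP aM (x + I * aM)) z := by
  have h1 : ContinuousAt (fun x => 2 * cosh (Real.pi * (x + I * aM / 2) / aP) *
      hyperbolicGamma aP aM x) z :=
    ContinuousAt.mul (by fun_prop) (continuousAt_hyperbolicGamma hP hM hz)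
  refine h1.congr ?_
  have h2 : ∀ᶠ x : ℂ in 𝓝 z, |x.im| < (aP + aM) / 2 :=
    (continuous_abs.comp continuous_im).continuousAt.eventually_lt continuousAt_const hz
  filter_upwards [h2] with x hx
  exact (hyperbolicGamma_add_right hP hM (abs_lt.1 hx).1).symm

/-! ### The difference equation with step `a₊` -/

theorem hyperbolicGamma_add_left_of_lt {aP aM : ℝ} (hP : 0 < aP) (hM : 0 < aM) {u : ℂ}
    (hu : -((aP + aM) / 2) < u.im) (hup : u.im + aP < (aP + aM) / 2) :
    hyperbolicGamma aP aM (u + I * aP) =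
      2 * cosh (Real.pi * (u + I * aP / 2) / aM) * hyperbolicGamma aP aM u := by
  have him : (u + I * aP).im = u.im + aP := by simp
  rw [hyperbolicGamma_eq_exp hM (by rw [him, abs_lt]; constructor <;> linarith),
    hyperbolicGamma_eq_exp hM (by rw [abs_lt]; constructor <;> linarith),
    gammaPhase_comm, gammaPhase_comm aP]
  exact exp_gammaPhase_add hM hP (by linarith) (by linarith)

theorem hyperbolicGamma_add_left_of_eq {aP aM : ℝ} (hP : 0 < aP) (hM : 0 < aM) {u : ℂ}
    (hu : u.im + aP = (aP + aM) / 2) :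
    hyperbolicGamma aP aM (u + I * aP) =
      2 * cosh (Real.pi * (u + I * aP / 2) / aM) * hyperbolicGamma aP aM u := by
  have hcurve : Tendsto (fun ε : ℝ => u - I * ε) (𝓝[>] 0) (𝓝 u) := by
    have : Continuous fun ε : ℝ => u - I * ε := by fun_prop
    have h := this.tendsto 0
    simp only [ofReal_zero, mul_zero, sub_zero] at h
    exact h.mono_left nhdsWithin_le_nhds
  have c1 : ContinuousAt (fun x => hyperbolicGamma aP aM (x + I * aP)) u := by
    have h := continuousAt_hyperbolicGamma_add hP hM (z := u + I * aP - I * aM) (by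
      have : (u + I * aP - I * aM).im = u.im + aP - aM := by simp
      rw [this, abs_lt]; constructor <;> linarith)
    have h2 : ContinuousAt (fun x : ℂ => x + I * aP - I * aM) u := by fun_prop
    have h3 := ContinuousAt.comp (f := fun x : ℂ => x + I * aP - I * aM) h h2
    simpa [Function.comp_def] using h3
  have c2 : ContinuousAt (fun x => 2 * cosh (Real.pi * (x + I * aP / 2) / aM) *
      hyperbolicGamma aP aM x) u :=
    ContinuousAt.mul (by fun_prop)
      (continuousAt_hyperbolicGamma hP hM (by rw [abs_lt]; constructor <;> linarith))
  refine tendsto_nhds_unique_of_eventuallyEq (c1.tendsto.comp hcurve) (c2.tendsto.comp hcurve) ?_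
  filter_upwards [Ioo_mem_nhdsGT hM] with ε hε
  have him : (u - I * ε).im = u.im - ε := by simp
  exact hyperbolicGamma_add_left_of_lt hP hM (by rw [him]; linarith [hε.2])
    (by rw [him]; linarith [hε.1])

theorem hyperbolicGamma_add_left {aP aM : ℝ} (hP : 0 < aP) (hM : 0 < aM) {u : ℂ}
    (hu : -((aP + aM) / 2) < u.im) :
    hyperbolicGamma aP aM (u + I * aP) =
      2 * cosh (Real.pi * (u + I * aP / 2) / aM) * hyperbolicGamma aP aM u := by
  obtain ⟨n, hn⟩ := exists_nat_ge ((u.im + aP - (aP + aM) / 2) / aM)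
  rw [div_le_iff₀ hM] at hn
  induction n generalizing u with
  | zero =>
    rw [Nat.cast_zero, zero_mul, sub_nonpos] at hn
    rcases hn.lt_or_eq with h | h
    · exact hyperbolicGamma_add_left_of_lt hP hM hu h
    · exact hyperbolicGamma_add_left_of_eq hP hM h
  | succ n ih =>
    rcases le_or_gt (u.im + aP) ((aP + aM) / 2) with h | h
    · rcases h.lt_or_eq with h | h
      · exact hyperbolicGamma_add_left_of_lt hP hM hu h
      · exact hyperbolicGamma_add_left_of_eq hP hM h
    · obtain ⟨t, rfl⟩ : ∃ t, u = t + I * aM := ⟨u - I * aM, by ring⟩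
      have him : (t + I * aM).im = t.im + aM := by simp
      have himP : (t + I * aP).im = t.im + aP := by simp
      rw [him] at h hn
      push_cast at hn
      -- Being above height `(a₊ + a₋)/2` after adding both steps leaves `Im t` above its negative.
      have ht : -((aP + aM) / 2) < t.im := by linarith
      have h1 := ih ht (by linarith)
      have h2 := hyperbolicGamma_add_right hP hM ht
      have h3 := hyperbolicGamma_add_right hP hM (u := t + I * aP) (by rw [himP]; linarith)
      have hP' : (aP : ℂ) ≠ 0 := by exact_mod_cast hP.ne'
      have hM' : (aM : ℂ) ≠ 0 := by exact_mod_cast hM.ne'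
      have e1 : t + I * aM + I * aP = t + I * aP + I * aM := by ring
      -- The two steps commute: performing one first changes the sign of the cosh factor of the
      -- other, so either order yields the same sign.
      have e2 : Real.pi * (t + I * aP + I * aM / 2) / aP =
          Real.pi * (t + I * aM / 2) / aP + Real.pi * I := by field_simp; ring
      have e3 : Real.pi * (t + I * aM + I * aP / 2) / aM =
          Real.pi * (t + I * aP / 2) / aM + Real.pi * I := by field_simp; ring
      rw [e1, h3, h1, h2, e2, e3, cosh_add_pi_mul_I, cosh_add_pi_mul_I]
      ring

/-! ### Extension to the lower half plane -/

theorem exists_nat_eq_of_cosh_eq_zero {α β : ℝ} (hα : 0 < α) {u : ℂ}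
    (hu : u.im ≤ -((α + β) / 2)) (h : cosh (Real.pi * (u + I * β / 2) / α) = 0) :
    ∃ n : ℕ, u = -I * ((α + β) / 2 + n * α) := by
  rw [← cos_mul_I, cos_eq_zero_iff] at h
  obtain ⟨k, hk⟩ := h
  have hα' : (α : ℂ) ≠ 0 := by exact_mod_cast hα.ne'
  have hpi : (Real.pi : ℂ) ≠ 0 := by exact_mod_cast Real.pi_ne_zero
  have huk : u = -I * ((α + β) / 2 + k * α) := by
    field_simp at hk
    have h2 : (u * 2 + I * β) * I = α * (2 * k + 1) := by
      linear_combination hk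
    linear_combination (-I / 2) * h2 + (u + I * β / 2) * I_sq
  have him : u.im = -((α + β) / 2 + k * α) := by
    rw [huk]
    have : ((α + β) / 2 + k * α : ℂ) = (((α + β) / 2 + k * α : ℝ) : ℂ) := by push_cast; rfl
    rw [this]
    simp
  -- The zeros of cosh form a two-sided sequence; the height condition keeps the half that consists
  -- of poles of `G`.
  have hk0 : (0 : ℝ) ≤ k := by
    by_contra hneg
    have := mul_neg_of_neg_of_pos (not_le.1 hneg) hα
    linarith
  obtain ⟨n, rfl⟩ := Int.eq_ofNat_of_zero_le (show 0 ≤ k by exact_mod_cast hk0)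
  exact ⟨n, by simpa using huk⟩

/-- The reflection `G (-z) = 1 / G z` carries the difference equation from the upper to the lower
half plane. -/
theorem difference_equation_of_neg {G : ℂ → ℂ} (hneg : ∀ z, G (-z) = (G z)⁻¹) {α β : ℝ} {u : ℂ}
    (hc : cosh (Real.pi * (u + I * β / 2) / α) ≠ 0)
    (h : G (-(u + I * β) + I * β) =
      2 * cosh (Real.pi * (-(u + I * β) + I * β / 2) / α) * G (-(u + I * β))) :
    G (u + I * β) = 2 * cosh (Real.pi * (u + I * β / 2) / α) * G u := by
  have e1 : -(u + I * β) + I * β = -u := by ring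
  have e2 : Real.pi * (-(u + I * β) + I * β / 2) / α = -(Real.pi * (u + I * β / 2) / α) := by ring
  rw [e1, e2, cosh_neg, hneg, hneg] at h
  generalize cosh (Real.pi * (u + I * β / 2) / α) = c at h hc ⊢
  rw [← inv_inj, mul_inv, h]
  field_simp

theorem hyperbolicGamma_difference_right {aP aM : ℝ} (hP : 0 < aP) (hM : 0 < aM) {u : ℂ}
    (hu : u ∉ hyperbolicGammaPoles aP aM) :
    hyperbolicGamma aP aM (u + I * aM) =
      2 * cosh (Real.pi * (u + I * aM / 2) / aP) * hyperbolicGamma aP aM u := by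
  rcases lt_or_ge (-((aP + aM) / 2)) u.im with h | h
  · exact hyperbolicGamma_add_right hP hM h
  · refine difference_equation_of_neg (hyperbolicGamma_neg aP aM) (fun h0 => hu ?_)
      (hyperbolicGamma_add_right hP hM ?_)
    · obtain ⟨n, hn⟩ := exists_nat_eq_of_cosh_eq_zero hP h h0
      exact ⟨n, 0, by simpa using hn⟩
    -- The reflected point has height `-Im u - a₋ ≥ (a₊ - a₋)/2`, which is above `-(a₊ + a₋)/2`.
    · simp; linarith

theorem hyperbolicGamma_difference_left {aP aM : ℝ} (hP : 0 < aP) (hM : 0 < aM) {u : ℂ}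
    (hu : u ∉ hyperbolicGammaPoles aP aM) :
    hyperbolicGamma aP aM (u + I * aP) =
      2 * cosh (Real.pi * (u + I * aP / 2) / aM) * hyperbolicGamma aP aM u := by
  rcases lt_or_ge (-((aP + aM) / 2)) u.im with h | h
  · exact hyperbolicGamma_add_left hP hM h
  · refine difference_equation_of_neg (hyperbolicGamma_neg aP aM) (fun h0 => hu ?_)
      (hyperbolicGamma_add_left hP hM ?_)
    · obtain ⟨n, hn⟩ := exists_nat_eq_of_cosh_eq_zero hM (by linarith) h0
      exact ⟨0, n, by rw [hn]; push_cast; ring⟩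
    · simp; linarith

end A3Kernel

end

theorem theorem3p3 (aP aM : ℝ) (haP : 0 < aP) (haM : 0 < aM) (d : ℂ) (v w : Fin 4 → ℂ)
    (hv : ∑ j, v j = 0) (hw : ∑ j, w j = 0) :
    (A3Kernel.IsRegularPoint aP aM aP aM d v w →
      A3Kernel.opA3 aP aM (fun x => A3Kernel.kernelS3 aP aM d x w) v =
        A3Kernel.opA3 aP aM (fun x => A3Kernel.kernelS3 aP aM d v x) w) ∧
    (A3Kernel.IsRegularPoint aP aM aM aP d v w →
      A3Kernel.opA3 aM aP (fun x => A3Kernel.kernelS3 aP aM d x w) v =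
        A3Kernel.opA3 aM aP (fun x => A3Kernel.kernelS3 aP aM d v x) w) := by
  refine ⟨fun h => ?_, fun h => ?_⟩
  · exact A3Kernel.kernel_identity_of_difference_equation haP.ne' _ d _ rfl hv hw h.left_ne
      h.right_ne
      (fun k l => A3Kernel.hyperbolicGamma_difference_right haP haM (h.not_pole_add k l))
      (fun k l => A3Kernel.hyperbolicGamma_difference_right haP haM (h.not_pole_sub k l))
  · exact A3Kernel.kernel_identity_of_difference_equation haM.ne' _ d _ (by ring) hv hw h.left_ne
      h.right_ne
      (fun k l => A3Kernel.hyperbolicGamma_difference_left haP haM (h.not_pole_add k l))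
      (fun k l => A3Kernel.hyperbolicGamma_difference_left haP haM (h.not_pole_sub k l))
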